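/- Let $\mathbf X=(X_t)_{t\in\mathbb R}$ be a real stochastic process on a probability space $(\Omega,\mathcal F,P)$, let $\mathcal F_{\le s}=\sigma(X_r:r\le s)$ and let $\mu$ be the law of $X_0$. Assume: (a) $\mathbf X$ is a Markov process, the law of $X_t$ does not depend on $t$, and the conditional law of $X_t$ given $X_s$, $s<t$, depends only on $t-s$; $E|X_t|^n<\infty$ for all $n$, and $\mu$ is determined by its moments; (b) for all distinct $s_1,\dots,s_n\in\mathbb R$ the matrix $[\operatorname{cov}(X_{s_i},X_{s_j})]$ is nonsingular, and for all $m,j\ge 0$ and $s$ the function $t\mapsto E X_t^mX_s^j$ is continuous at $t=s$; (c) (polynomial regression) $E(X_t^n\mid\mathcal F_{\le s})=\sum_{j=0}^n\gamma_{n,j}(t-s)X_s^j$ a.s. for all $n\ge 0$ and $s<t$, and the lower triangular matrices $A_n(t)=[\gamma_{i,j}(t)]_{0\le j\le i\le n}$ are diagonalized as $A_n(t)=V_n\,\mathrm{diag}(e^{-\alpha_0t},e^{-\alpha_1t},\dots,e^{-\alpha_nt})\,V_n^{-1}$ for $t>0$, where $\alpha_i\in\mathbb R$ and $V_n^{-1}(1,x,\dots,x^n)^T=(p_0(x),\dots,p_n(x))^T$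 for some monic polynomials $p_i$ with $\deg p_i=i$ (not depending on $n$); (d) (regularity) the polynomials $p_n$ are mutually orthogonal in $L_2(\mu)$; put $h_n=p_n/\sqrt{E\,p_n(X_0)^2}$; (e) (independent regression property) for all $s<t$ and $j\ge1$ the conditional moment $E\bigl((X_t-E(X_t\mid\mathcal F_{\le s}))^j\mid\mathcal F_{\le s}\bigr)$ is a.s. equal to a constant; (f) $EX_0=0$, and there are reals $\delta_j$ ($j\ge 2$) and $r>0$ such that for $|y|<r$ the series below converges, the expectation is finite, and $E e^{yX_0}=\exp\bigl(\sum_{j\ge2}\delta_jy^j/j!\bigr)$. (Such $\mathbf X$ is called a $\{\delta_j\}$-RSMPRIR process.) Define $\mathbf Y=(Y_\tau)_{\tau\ge0}$ by $Y_\tau=\sqrt\tau\,X_{(\ln\tau)/(2\alpha_1)}$ for $\tau>0$ and $Y_0=0$. Then: (i) $\mathbf Y$ has independent increments and is a harness: $\mathbf Y$ is a Markov process with finite first moments, and for all $0\le s\le t\le u$ the conditional expectation $E(Y_t\mid\sigma(Y_r:r\notin(s,u)))$ is a polynomial of degree $1$ in $Y_s$ and $Y_u$. (ii) For all $\tau\ge0$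 and all real $y$ with $\sqrt\tau\,|y|<r$, $$E e^{yY_\tau}=\exp\Bigl(\sum_{j\ge2}\delta_j\tau^{j/2}\frac{y^j}{j!}\Bigr),$$ and for all $0\le\sigma<\tau$ and all real $y$ with $\sqrt\tau\,|y|<r$, $$E e^{y(Y_\tau-Y_\sigma)}=\exp\Bigl(\sum_{j\ge2}\delta_j(\tau^{j/2}-\sigma^{j/2})\frac{y^j}{j!}\Bigr),$$ with finite expectations and convergent series. Moreover $\mathbf Y$ is a Lévy process ($Y_0=0$ a.s., independent and stationary increments) if and only if $\mathbf X$ is an Ornstein–Uhlenbeck process (a centred Gaussian process with covariance $v e^{-a|t-s|}$ for some $a,v>0$), and this holds if and only if the $h_n$ are Hermite polynomials, i.e. $h_n(x)=He_n(x/\sqrt v)/\sqrt{n!}$ for all $n\ge 0$, for some $v>0$, where $He_n$ are the probabilists' Hermite polynomials. -/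

import Mathlib

open MeasureTheory ProbabilityTheory Filter Topology Polynomial
open scoped NNReal ENNReal Nat

noncomputable section

section Processes

variable {Ω ι : Type*} [mΩ : MeasurableSpace Ω] [LinearOrder ι]

/-- The past `𝓕_{≤ s} = σ(Z_r : r ≤ s)`. -/
@[reducible] def pastSigma (Z : ι → Ω → ℝ) (s : ι) : MeasurableSpace Ω :=
  ⨆ r ∈ Set.Iic s, MeasurableSpace.comap (Z r) inferInstance

/-- The two-sided field `𝓕_{s,u} = σ(Z_r : r ∉ (s,u))`. -/
@[reducible] def outerSigma (Z : ι → Ω → ℝ) (s u : ι) : MeasurableSpace Ω :=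
  ⨆ r ∈ (Set.Ioo s u)ᶜ, MeasurableSpace.comap (Z r) inferInstance

/-- The Markov property with respect to the natural filtration:
`P(Z_t ∈ B | 𝓕_{≤ s}) = P(Z_t ∈ B | Z_s)` a.s. for all `s ≤ t` and all Borel sets `B`. -/
def IsMarkovProcess (Z : ι → Ω → ℝ) (P : Measure Ω) : Prop :=
  (∀ t, Measurable (Z t)) ∧
  ∀ s t, s ≤ t → ∀ B : Set ℝ, MeasurableSet B →
    P[(Z t ⁻¹' B).indicator (fun _ => (1 : ℝ)) | pastSigma Z s] =ᵐ[P]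
      P[(Z t ⁻¹' B).indicator (fun _ => (1 : ℝ)) | MeasurableSpace.comap (Z s) inferInstance]

/-- `r`-harness: a Markov process with finite absolute `r`-th moments such that for
`s ≤ t ≤ u` the conditional moment `E(Z_t^r | 𝓕_{s,u})` is a polynomial of degree `r` in
`Z_s` and `Z_u` (with nonrandom coefficients, which may depend on `s, t, u`). -/
def IsRHarness (r : ℕ) (Z : ι → Ω → ℝ) (P : Measure Ω) : Prop :=
  IsMarkovProcess Z P ∧
  (∀ t, Integrable (fun ω => |Z t ω| ^ r) P) ∧
  ∀ s t u, s ≤ t → t ≤ u → ∃ Q : MvPolynomial (Fin 2) ℝ, Q.totalDegree = r ∧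
    P[fun ω => Z t ω ^ r | outerSigma Z s u] =ᵐ[P]
      fun ω => MvPolynomial.eval ![Z s ω, Z u ω] Q

/-- A harness is a `1`-harness. -/
def IsHarness (Z : ι → Ω → ℝ) (P : Measure Ω) : Prop := IsRHarness 1 Z P

end Processes

variable {Ω : Type*} [mΩ : MeasurableSpace Ω]

/-- Lévy process on `[0, ∞)`: it starts at `0` and has independent and stationary increments.
No regularity of paths is required. -/
structure IsLevyProcess (Z : ℝ≥0 → Ω → ℝ) (P : Measure Ω) : Prop where
  zero : Z 0 =ᵐ[P] 0
  indep : HasIndepIncrements Z P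
  stationary : ∀ s t, s ≤ t → IdentDistrib (fun ω => Z t ω - Z s ω) (Z (t - s)) P P

/-- Ornstein–Uhlenbeck process: centred Gaussian with covariance `v exp(-a|t-s|)`, where
`a, v > 0`. -/
def IsOrnsteinUhlenbeck (X : ℝ → Ω → ℝ) (P : Measure Ω) : Prop :=
  IsGaussianProcess X P ∧ (∀ t, ∫ ω, X t ω ∂P = 0) ∧
  ∃ a v : ℝ, 0 < a ∧ 0 < v ∧
    ∀ s t, covariance (X s) (X t) P = v * Real.exp (-a * |t - s|)

/-- A strictly stationary (time-homogeneous, with constant one-dimensional laws) Markov process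
indexed by `ℝ`; `η τ` is the transition kernel over a time span `τ`. -/
structure IsStationaryMarkov (X : ℝ → Ω → ℝ) (P : Measure Ω) : Prop where
  markov : IsMarkovProcess X P
  marginal : ∀ t, P.map (X t) = P.map (X 0)
  homogeneous : ∃ η : ℝ → Kernel ℝ ℝ, (∀ τ, IsMarkovKernel (η τ)) ∧
    ∀ s t, s < t → ∀ B : Set ℝ, MeasurableSet B →
      P[(X t ⁻¹' B).indicator (fun _ => (1 : ℝ)) |
          MeasurableSpace.comap (X s) inferInstance] =ᵐ[P]
        fun ω => (η (t - s) (X s ω)).real B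

/-- The law `μ` has moments of all orders and is the only probability law with these moments. -/
def IsMomentDeterminate (μ : Measure ℝ) : Prop :=
  (∀ n : ℕ, Integrable (fun x : ℝ => x ^ n) μ) ∧
  ∀ ν : Measure ℝ, IsProbabilityMeasure ν → (∀ n : ℕ, Integrable (fun x : ℝ => x ^ n) ν) →
    (∀ n : ℕ, ∫ x, x ^ n ∂ν = ∫ x, x ^ n ∂μ) → ν = μ

/-- Totally linearly dependent: covariance matrices at distinct times are nonsingular. -/
def IsTLD (X : ℝ → Ω → ℝ) (P : Measure Ω) : Prop :=
  ∀ (n : ℕ) (s : Fin n → ℝ), Function.Injective s →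
    (Matrix.of fun i j => covariance (X (s i)) (X (s j)) P).det ≠ 0

/-- Mean-square continuity: every mixed moment `E X_t^m X_s^j` is continuous at `t = s`. -/
def IsMSC (X : ℝ → Ω → ℝ) (P : Measure Ω) : Prop :=
  ∀ (m j : ℕ) (s : ℝ), ContinuousAt (fun t => ∫ ω, X t ω ^ m * X s ω ^ j ∂P) s

/-- The lower triangular matrix `A_n(t)` with entries `γ_{i,j}(t)`, `0 ≤ j ≤ i ≤ n`. -/
def regressionMatrix (γ : ℕ → ℕ → ℝ → ℝ) (n : ℕ) (t : ℝ) :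
    Matrix (Fin (n + 1)) (Fin (n + 1)) ℝ :=
  Matrix.of fun i j => if (j : ℕ) ≤ i then γ i j t else 0

/-- The matrix whose rows are the coefficients of `p_0, …, p_n`, that is
`(p_0(x), …, p_n(x))ᵀ = coeffMatrix p n * (1, x, …, x^n)ᵀ` if `deg p_i ≤ n`. -/
def coeffMatrix (p : ℕ → ℝ[X]) (n : ℕ) : Matrix (Fin (n + 1)) (Fin (n + 1)) ℝ :=
  Matrix.of fun i j => (p i).coeff j

/-- `X` is a stationary Markov process with polynomial regression, with regression coefficients
`γ_{n,j}`, correlation indices `α_n` and monic polynomials `p_n`. The last field is the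
diagonalization `A_n(t) = V_n Λ_n(t) V_n⁻¹`, where `Λ_n(t) = diag(e^{-α_0 t}, …, e^{-α_n t})` and
the polynomials `p_n` are read off the rows of `V_n⁻¹`. -/
structure IsSMPR (X : ℝ → Ω → ℝ) (P : Measure Ω)
    (γ : ℕ → ℕ → ℝ → ℝ) (α : ℕ → ℝ) (p : ℕ → ℝ[X]) : Prop where
  stationaryMarkov : IsStationaryMarkov X P
  moments : ∀ (n : ℕ) (t : ℝ), Integrable (fun ω => |X t ω| ^ n) P
  determinate : IsMomentDeterminate (P.map (X 0))
  tld : IsTLD X P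
  msc : IsMSC X P
  regression : ∀ (n : ℕ) (s t : ℝ), s < t →
    P[fun ω => X t ω ^ n | pastSigma X s] =ᵐ[P]
      fun ω => ∑ j ∈ Finset.range (n + 1), γ n j (t - s) * X s ω ^ j
  monic : ∀ n, (p n).Monic
  natDegree : ∀ n, (p n).natDegree = n
  diagonalization : ∀ (n : ℕ) (t : ℝ), 0 < t →
    regressionMatrix γ n t =
      (coeffMatrix p n)⁻¹ *
        Matrix.diagonal (fun i : Fin (n + 1) => Real.exp (-α i * t)) * coeffMatrix p n

/-- Regular: the polynomials `p_n` are orthogonal with respect to the stationary law. -/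
structure IsRSMPR (X : ℝ → Ω → ℝ) (P : Measure Ω)
    (γ : ℕ → ℕ → ℝ → ℝ) (α : ℕ → ℝ) (p : ℕ → ℝ[X]) : Prop extends IsSMPR X P γ α p where
  orthogonal : ∀ m n, m ≠ n → ∫ x, (p m).eval x * (p n).eval x ∂(P.map (X 0)) = 0

/-- Independent regression property: the conditional central moments
`E((X_t - E(X_t | 𝓕_{≤ s}))^j | 𝓕_{≤ s})` are a.s. nonrandom. -/
def HasIndepRegression (X : ℝ → Ω → ℝ) (P : Measure Ω) : Prop :=
  ∀ s t : ℝ, s < t → ∀ j : ℕ, 1 ≤ j → ∃ c : ℝ,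
    P[fun ω => (X t ω - (P[X t | pastSigma X s]) ω) ^ j | pastSigma X s] =ᵐ[P] fun _ => c

/-- At the point `y` the moment generating function of `Z` is finite and equal to
`exp (∑_{j ≥ 2} c_j y^j / j!)`, with a convergent series. -/
def MGFEqExpSeries (Z : Ω → ℝ) (P : Measure Ω) (c : ℕ → ℝ) (y : ℝ) : Prop :=
  Integrable (fun ω => Real.exp (y * Z ω)) P ∧
  Summable (fun j : ℕ => c (j + 2) * y ^ (j + 2) / ((j + 2)! : ℝ)) ∧
  ∫ ω, Real.exp (y * Z ω) ∂P =
    Real.exp (∑' j : ℕ, c (j + 2) * y ^ (j + 2) / ((j + 2)! : ℝ))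

/-- `X` is a `{δ_j}`-RSMPRIR process: regular, with the independent regression property, centred,
and the m.g.f. of `X_0` is `exp (∑_{j ≥ 2} δ_j y^j / j!)` on the neighbourhood `(-r, r)` of `0`. -/
structure IsDeltaRSMPRIR (X : ℝ → Ω → ℝ) (P : Measure Ω)
    (γ : ℕ → ℕ → ℝ → ℝ) (α : ℕ → ℝ) (p : ℕ → ℝ[X]) (δ : ℕ → ℝ) (r : ℝ) : Prop
    extends IsRSMPR X P γ α p where
  indepRegression : HasIndepRegression X P
  centred : ∫ ω, X 0 ω ∂P = 0
  radius_pos : 0 < r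
  mgf_eq : ∀ y : ℝ, |y| < r → MGFEqExpSeries (X 0) P δ y

/-- The orthonormal polynomials `h_n = p_n / (E p_n(X_0)^2)^{1/2}`. -/
def orthonormalPoly (X : ℝ → Ω → ℝ) (P : Measure Ω) (p : ℕ → ℝ[X]) (n : ℕ) : ℝ[X] :=
  C (Real.sqrt (∫ ω, ((p n).eval (X 0 ω)) ^ 2 ∂P))⁻¹ * p n

/-- The `h_n` are the (orthonormal, probabilists') Hermite polynomials of some centred normal
law `N(0, v)`, `v > 0`. -/
def AreHermitePolynomials (h : ℕ → ℝ[X]) : Prop :=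
  ∃ v : ℝ, 0 < v ∧ ∀ (n : ℕ) (x : ℝ),
    (h n).eval x = aeval (x / Real.sqrt v) (hermite n) / Real.sqrt (n ! : ℝ)

/-- `Y_τ = √τ X_{(ln τ)/(2a)}` for `τ > 0`, and `Y_0 = 0`. -/
def timeChanged (X : ℝ → Ω → ℝ) (a : ℝ) (τ : ℝ≥0) (ω : Ω) : ℝ :=
  Real.sqrt τ * X (Real.log τ / (2 * a)) ω

end

noncomputable section

/-! ### Gaussian moment recurrences -/

/-! The hypotheses force `X` to be Gaussian. Write ρ = exp(-α₁(t-s)), let D = X_t - ρ X_s be the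
innovation, and let M and C be the exponential generating series of the moments of X_0 and of D.
Constant conditional moments give E D^j X_s^k = E D^j · E X_0^k, so stationarity reads M(y) = M(ρy)
C(y). Each p_n(X) is an eigenfunction of conditional expectation and p_1 = x is orthogonal to every
other p_n, so E f(X_t) X_s = ρ E f(X_0) X_0 for all polynomials f; this weak reversibility reads ρ
M'(y) = M'(ρy) C(y). Dividing, the logarithmic derivative ℓ = M'/M satisfies ℓ(ρy) = ρ ℓ(y) with 0 <
ρ < 1, hence ℓ(y) = v y.

The argument is carried out on moments: `moment_recurrence` and `innovation_recurrence` are the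
Gaussian recurrences for X_0 and D. Determinacy of μ identifies the law of X_0 (`map_zero_eq`).
Applied to the normalized D conditioned on a past event, it upgrades constant conditional moments to
genuine independence of the past (`indep_innovation`).

The increments of the time-changed process are multiples of innovations, so that process is √v times
a Brownian motion (`isPreBrownianReal`). The harness property is then Gaussian linear interpolation,
the cumulants are δ_2 = v and δ_j = 0 for j ≥ 3, and p_n is the Hermite polynomial of variance v by
uniqueness of monic orthogonal polynomials. All the conditions in the stated equivalences therefore
hold outright. -/

theorem integrable_pow_gaussianReal (v : ℝ≥0) (n : ℕ) :
    Integrable (fun x : ℝ => x ^ n) (gaussianReal 0 v) := by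
  rcases Nat.eq_zero_or_pos n with rfl | hn
  · simp
  have h : MemLp (id : ℝ → ℝ) (n : ℝ≥0∞) (gaussianReal 0 v) :=
    memLp_id_gaussianReal' _ (by simp)
  have h' := h.integrable_norm_pow (by omega)
  refine h'.mono' (by fun_prop) (ae_of_all _ fun x => by simp)

/-- Differentiate f' = v t f repeatedly. At t = 0 the first term drops out and the two-step
recurrence for Gaussian moments remains. -/
theorem iteratedDeriv_gaussian_mgf (v : ℝ) (n : ℕ) (t : ℝ) :
    iteratedDeriv (n + 2) (fun t : ℝ => Real.exp (v * t ^ 2 / 2)) t =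
      v * (t * iteratedDeriv (n + 1) (fun t : ℝ => Real.exp (v * t ^ 2 / 2)) t
        + (n + 1) * iteratedDeriv n (fun t : ℝ => Real.exp (v * t ^ 2 / 2)) t) := by
  set f : ℝ → ℝ := fun t : ℝ => Real.exp (v * t ^ 2 / 2) with hf
  have hfs : ContDiff ℝ ⊤ f := by fun_prop
  have hd : ∀ k t, HasDerivAt (iteratedDeriv k f) (iteratedDeriv (k + 1) f t) t := by
    intro k t
    rw [iteratedDeriv_succ]
    exact ((hfs.differentiable_iteratedDeriv k (by exact WithTop.coe_lt_top _)) t).hasDerivAt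
  have h1 : ∀ t, iteratedDeriv 1 f t = v * (t * f t) := by
    intro t
    rw [iteratedDeriv_one]
    have : HasDerivAt f (Real.exp (v * t ^ 2 / 2) * (v * (2 * t) / 2)) t := by
      refine HasDerivAt.exp ?_
      have := ((hasDerivAt_pow 2 t).const_mul v).div_const 2
      simpa using this
    rw [this.deriv]; simp only [hf]; ring
  induction n generalizing t with
  | zero =>
    have h : iteratedDeriv 1 f = fun t => v * (t * f t) := funext h1
    have hd0 : HasDerivAt f (iteratedDeriv 1 f t) t := by simpa using hd 0 t
    have : HasDerivAt (fun t => v * (t * f t)) (v * (1 * f t + t * iteratedDeriv 1 f t)) t :=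
      ((hasDerivAt_id t).mul hd0).const_mul v
    have h2 : iteratedDeriv 2 f t = deriv (fun t => v * (t * f t)) t := by
      rw [← h, ← iteratedDeriv_succ]
    rw [zero_add, h2, HasDerivAt.deriv this, iteratedDeriv_zero, zero_add]
    push_cast; ring
  | succ n ih =>
    have h : iteratedDeriv (n + 2) f = fun t =>
        v * (t * iteratedDeriv (n + 1) f t + (n + 1) * iteratedDeriv n f t) := funext ih
    have : HasDerivAt (fun t => v * (t * iteratedDeriv (n + 1) f t + (n + 1) * iteratedDeriv n f t))
        (v * (1 * iteratedDeriv (n + 1) f t + t * iteratedDeriv (n + 2) f t +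
          (n + 1) * iteratedDeriv (n + 1) f t)) t :=
      (((hasDerivAt_id t).mul (hd (n + 1) t)).add
        ((hd n t).const_mul ((n : ℝ) + 1))).const_mul v
    rw [iteratedDeriv_succ, h, HasDerivAt.deriv this, ← h]
    push_cast; ring

theorem integral_pow_add_two_gaussianReal (v : ℝ≥0) (n : ℕ) :
    ∫ x, x ^ (n + 2) ∂gaussianReal 0 v = (n + 1) * v * ∫ x, x ^ n ∂gaussianReal 0 v := by
  have h0 : (0 : ℝ) ∈ interior (integrableExpSet id (gaussianReal 0 v)) := by
    rw [integrableExpSet_id_gaussianReal]; simp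
  have h1 := iteratedDeriv_mgf_zero h0 (n + 2)
  have h2 := iteratedDeriv_mgf_zero h0 n
  simp only [mgf_id_gaussianReal, zero_mul, zero_add, iteratedDeriv_gaussian_mgf] at h1 h2
  rw [h2] at h1
  simp only [Pi.pow_apply, id] at h1
  rw [← h1]; ring

/-- Two sequences satisfying the same two-step recurrence with the same initial data agree. -/
theorem eq_of_two_step {a b : ℕ → ℝ} {w : ℝ} (h0 : a 0 = b 0) (h1 : a 1 = b 1)
    (ha : ∀ n, a (n + 2) = (n + 1) * w * a n) (hb : ∀ n, b (n + 2) = (n + 1) * w * b n) :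
    ∀ n, a n = b n := by
  intro n
  induction n using Nat.strong_induction_on with
  | _ n ih =>
    match n with
    | 0 => exact h0
    | 1 => exact h1
    | n + 2 => rw [ha, hb, ih n (by omega)]

/-! ### Moments of a reversible linear autoregression -/

section Moments

variable {m c : ℕ → ℝ} {ρ v : ℝ}

/-- `hA` is stationarity and `hB` is reversibility against x; in generating series they say M(y) =
M(ρy) C(y) and ρ M'(y) = M'(ρy) C(y). -/
theorem moment_recurrence (hρ0 : 0 < ρ) (hρ1 : ρ < 1) (m0 : m 0 = 1) (m1 : m 1 = 0) (m2 : m 2 = v)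
    (c0 : c 0 = 1)
    (hA : ∀ n, m n = ∑ k ∈ Finset.range (n + 1), (n.choose k : ℝ) * ρ ^ k * m k * c (n - k))
    (hB : ∀ n, ρ * m (n + 1) =
      ∑ k ∈ Finset.range (n + 1), (n.choose k : ℝ) * ρ ^ k * m (k + 1) * c (n - k)) (j : ℕ) :
    m (j + 2) = (j + 1) * v * m j := by
  induction j using Nat.strong_induction_on with
  | _ j ih =>
    rcases Nat.eq_zero_or_pos j with rfl | hj
    · simp [m0, m2]
    -- The defects m_{k+2} - (k+1) v m_k satisfy a linear relation of their own: subtract (j+1) v ρ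
    -- times `hA` at j from `hB` at j + 1.
    have key : ρ * (m (j + 2) - (j + 1) * v * m j) =
        ∑ k ∈ Finset.range (j + 1), ((j + 1).choose (k + 1) : ℝ) * ρ ^ (k + 1) *
          (m (k + 2) - (k + 1) * v * m k) * c (j - k) := by
      rw [mul_sub, hB (j + 1), Finset.sum_range_succ']
      simp only [m1, zero_add, mul_zero, zero_mul, add_zero]
      have : ρ * ((j + 1) * v * m j) = ∑ k ∈ Finset.range (j + 1),
          ((j + 1).choose (k + 1) : ℝ) * ρ ^ (k + 1) * ((k + 1) * v * m k) * c (j - k) := by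
        conv_lhs => rw [hA j]
        rw [Finset.mul_sum, Finset.mul_sum]
        refine Finset.sum_congr rfl fun k _ => ?_
        have h := Nat.add_one_mul_choose_eq j k
        have h' : ((j : ℝ) + 1) * (j.choose k : ℝ) = ((j + 1).choose (k + 1) : ℝ) * (k + 1) := by
          exact_mod_cast h
        linear_combination ρ ^ (k + 1) * v * m k * c (j - k) * h'
      rw [this, ← Finset.sum_sub_distrib]
      refine Finset.sum_congr rfl fun k _ => ?_
      rw [show j + 1 - (k + 1) = j - k by omega]; ring
    -- By induction only the term k = j survives, leaving ρ (1 - ρ^j) times the defect equal to 0.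
    -- The factor is nonzero because j > 0, which is why j = 0 was split off.
    rw [Finset.sum_range_succ, Finset.sum_eq_zero] at key
    · have h1 : ρ ^ j < 1 := pow_lt_one₀ hρ0.le hρ1 (by omega)
      simp only [Nat.choose_self, Nat.cast_one, Nat.sub_self, c0] at key
      have : ρ * (1 - ρ ^ j) * (m (j + 2) - (j + 1) * v * m j) = 0 := by
        linear_combination key
      rcases mul_eq_zero.1 this with h | h
      · rcases mul_eq_zero.1 h with h | h <;> linarith
      · linarith
    · intro k hk
      rw [ih k (Finset.mem_range.1 hk)]; ring

/-- Two expansions of (1 - ρ²) m_{j+2} have the same coefficients C(j+1,k) ρ^k m_k. Their terms with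
k ≥ 1 agree by induction, so the terms k = 0 must agree, and these are the claim. -/
theorem innovation_recurrence (m0 : m 0 = 1) (c1 : c 1 = 0)
    (hA : ∀ n, m n = ∑ k ∈ Finset.range (n + 1), (n.choose k : ℝ) * ρ ^ k * m k * c (n - k))
    (hB : ∀ n, ρ * m (n + 1) =
      ∑ k ∈ Finset.range (n + 1), (n.choose k : ℝ) * ρ ^ k * m (k + 1) * c (n - k))
    (hm : ∀ j : ℕ, m (j + 2) = (j + 1) * v * m j) (j : ℕ) :
    c (j + 2) = (j + 1) * ((1 - ρ ^ 2) * v) * c j := by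
  induction j using Nat.strong_induction_on with
  | _ j ih =>
    have e1 : (1 - ρ ^ 2) * m (j + 2) = ∑ k ∈ Finset.range (j + 1),
        ((j + 1).choose k : ℝ) * ρ ^ k * m k * c (j + 2 - k) := by
      have h := hA (j + 2)
      rw [Finset.sum_range_succ'] at h
      -- Pascal's rule splits `hA` at j + 2; by `hB` the first part sums to ρ² m_{j+2}, which moves
      -- to the left-hand side.
      have h2 : ∀ k ∈ Finset.range (j + 2),
          ((j + 2).choose (k + 1) : ℝ) * ρ ^ (k + 1) * m (k + 1) * c (j + 2 - (k + 1)) =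
          ρ * (((j + 1).choose k : ℝ) * ρ ^ k * m (k + 1) * c (j + 1 - k)) +
          ((j + 1).choose (k + 1) : ℝ) * ρ ^ (k + 1) * m (k + 1) * c (j + 2 - (k + 1)) := by
        intro k _
        rw [Nat.choose_succ_succ, show j + 2 - (k + 1) = j + 1 - k by omega]
        push_cast; ring
      rw [Finset.sum_congr rfl h2, Finset.sum_add_distrib, ← Finset.mul_sum, ← hB,
        Finset.sum_range_succ (n := j + 1), Finset.sum_range_succ (n := j)] at h
      rw [Finset.sum_range_succ']
      simp at h ⊢
      simp [c1] at h
      linarith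
    have e2 : (1 - ρ ^ 2) * m (j + 2) = ∑ k ∈ Finset.range (j + 1),
        ((j + 1).choose k : ℝ) * ρ ^ k * m k *
          (((j - k : ℕ) + 1) * ((1 - ρ ^ 2) * v) * c (j - k)) := by
      rw [hm, hA j, Finset.mul_sum, Finset.mul_sum]
      refine Finset.sum_congr rfl fun k hk => ?_
      have hkj : k ≤ j := by have := Finset.mem_range.1 hk; omega
      have h := Nat.choose_mul_succ_eq j k
      have h' : (j.choose k : ℝ) * (j + 1) = ((j + 1).choose k : ℝ) * ((j - k : ℕ) + 1) := by
        rw [show j + 1 - k = (j - k) + 1 by omega] at h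
        exact_mod_cast h
      linear_combination (1 - ρ ^ 2) * v * ρ ^ k * m k * c (j - k) * h'
    rw [e1, Finset.sum_range_succ', Finset.sum_range_succ' _ j] at e2
    have : ∀ k ∈ Finset.range j, ((j + 1).choose (k + 1) : ℝ) * ρ ^ (k + 1) * m (k + 1) *
        c (j + 2 - (k + 1)) = ((j + 1).choose (k + 1) : ℝ) * ρ ^ (k + 1) * m (k + 1) *
          (((j - (k + 1) : ℕ) + 1) * ((1 - ρ ^ 2) * v) * c (j - (k + 1))) := by
      intro k hk
      have := Finset.mem_range.1 hk
      rw [show j + 2 - (k + 1) = (j - (k + 1)) + 2 by omega, ih _ (by omega)]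
    rw [Finset.sum_congr rfl this] at e2
    simpa [m0] using e2

end Moments

end

noncomputable section

/-! ### Hermite polynomials of variance `v` -/

/-- The monic Hermite polynomials of variance `v`, orthogonal for `N(0, v)`. -/
def varHermite (v : ℝ) : ℕ → ℝ[X]
  | 0 => 1
  | n + 1 => X * varHermite v n - C v * derivative (varHermite v n)

theorem varHermite_monic_natDegree (v : ℝ) (n : ℕ) :
    (varHermite v n).Monic ∧ (varHermite v n).natDegree = n := by
  induction n with
  | zero => simp [varHermite]
  | succ n ih =>
    have hXm : (X * varHermite v n).Monic := monic_X.mul ih.1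
    have hXd : (X * varHermite v n).natDegree = n + 1 := by
      rw [monic_X.natDegree_mul ih.1, ih.2, natDegree_X, add_comm]
    have hlt : (C v * derivative (varHermite v n)).degree < (X * varHermite v n).degree := by
      rw [degree_eq_natDegree hXm.ne_zero, hXd]
      refine lt_of_le_of_lt degree_le_natDegree ?_
      have h1 := natDegree_C_mul_le v (derivative (varHermite v n))
      have h2 := natDegree_derivative_le (varHermite v n)
      rw [ih.2] at h2
      exact_mod_cast (by omega : (C v * derivative (varHermite v n)).natDegree < n + 1)
    refine ⟨hXm.sub_of_left hlt, ?_⟩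
    show (X * varHermite v n - C v * derivative (varHermite v n)).natDegree = n + 1
    rw [natDegree_eq_of_degree_eq (degree_sub_eq_left_of_degree_lt hlt)]
    exact hXd

theorem varHermite_eq_comp {s : ℝ} (hs : s ≠ 0) (n : ℕ) :
    varHermite (s ^ 2) n =
      C (s ^ n) * ((hermite n).map (Int.castRingHom ℝ)).comp (C s⁻¹ * X) := by
  induction n with
  | zero => simp [varHermite]
  | succ n ih =>
    have hC : (C s : ℝ[X]) * C s⁻¹ = 1 := by rw [← C_mul, mul_inv_cancel₀ hs, C_1]
    simp only [varHermite, ih, hermite_succ, Polynomial.map_sub, Polynomial.map_mul, map_X,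
      sub_comp, mul_comp, X_comp, derivative_mul, derivative_C, derivative_comp, derivative_X,
      ← derivative_map]
    simp only [C_pow, zero_mul, zero_add, mul_one]
    linear_combination (-(C s) ^ n * X *
      ((hermite n).map (Int.castRingHom ℝ)).comp (C s⁻¹ * X) - C s ^ (n + 1) *
      (derivative ((hermite n).map (Int.castRingHom ℝ))).comp (C s⁻¹ * X)) * hC

theorem eval_varHermite {s : ℝ} (hs : s ≠ 0) (n : ℕ) (x : ℝ) :
    (varHermite (s ^ 2) n).eval x = s ^ n * aeval (x / s) (hermite n) := by
  rw [varHermite_eq_comp hs, aeval_def, eval_mul, eval_C, eval_comp, ← eval_map]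
  simp [div_eq_inv_mul]

section Functional

variable {L : ℝ[X] →ₗ[ℝ] ℝ} {v : ℝ}

/-- Under `L`, the raising operator f ↦ X f - v f' is the adjoint of v d/dx, so each step of the
Hermite recursion moves one derivative onto `q`. -/
theorem functional_varHermite_mul (hL : ∀ q, L (X * q) = v * L (derivative q)) (n : ℕ) (q : ℝ[X]) :
    L (varHermite v n * q) = v ^ n * L (derivative^[n] q) := by
  induction n generalizing q with
  | zero => simp [varHermite]
  | succ n ih =>
    have h1 : varHermite v (n + 1) * q = X * (varHermite v n * q) -
        v • (derivative (varHermite v n) * q) := by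
      rw [varHermite, smul_eq_C_mul]; ring
    rw [h1, map_sub, hL, map_smul, derivative_mul, map_add, ih, ← Function.iterate_succ_apply,
      smul_eq_mul]
    ring

theorem iterate_derivative_of_monic {q : ℝ[X]} {n : ℕ} (hq : q.Monic) (hn : q.natDegree = n) :
    derivative^[n] q = C (n ! : ℝ) := by
  have hd : (derivative^[n] q).natDegree = 0 := by
    have := natDegree_iterate_derivative q n
    omega
  rw [eq_C_of_natDegree_eq_zero hd, coeff_iterate_derivative, zero_add, ← hn, coeff_natDegree,
    hq.leadingCoeff, Nat.descFactorial_self]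
  simp

/-- Subtracting the multiple of p_k with the same leading term lowers the degree of `q` and costs
nothing, by orthogonality. -/
theorem functional_mul_eq_zero_of_natDegree_lt {p : ℕ → ℝ[X]} (hp : ∀ n, (p n).Monic)
    (hd : ∀ n, (p n).natDegree = n) (ho : ∀ m n, m ≠ n → L (p m * p n) = 0) (n : ℕ) (q : ℝ[X])
    (hq : q.degree < n) : L (p n * q) = 0 := by
  induction hk : q.natDegree using Nat.strong_induction_on generalizing q with
  | _ k ih =>
    by_cases hq0 : q = 0
    · simp [hq0]
    have hkn : k < n := by
      rw [degree_eq_natDegree hq0, hk] at hq; exact_mod_cast hq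
    set a := q.leadingCoeff with ha
    have ha0 : a ≠ 0 := leadingCoeff_ne_zero.2 hq0
    have hdeg : q.degree = (C a * p k).degree := by
      rw [degree_C_mul ha0, degree_eq_natDegree hq0, degree_eq_natDegree (hp k).ne_zero, hd, hk]
    have hlt : (q - C a * p k).degree < q.degree := by
      refine degree_sub_lt_left hdeg hq0 ?_
      rw [leadingCoeff_mul, leadingCoeff_C, (hp k).leadingCoeff, mul_one]
    have e : p n * q = p n * (q - C a * p k) + a • (p n * p k) := by
      rw [smul_eq_C_mul]; ring
    rw [e, map_add, map_smul, ho n k (by omega), smul_zero, add_zero]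
    by_cases hr : q - C a * p k = 0
    · simp [hr]
    · exact ih _ (by have := natDegree_lt_natDegree hr hlt; omega) _ (hlt.trans hq) rfl

/-- Suppose the difference q of the two monic polynomials is nonzero, of degree k < n. Pairing it
with the Hermite polynomial of degree k gives 0 by orthogonality, but v^k k! times the leading
coefficient of q by integration by parts. -/
theorem eq_varHermite_of_orthogonal (hL : ∀ q, L (X * q) = v * L (derivative q)) (h1 : L 1 = 1)
    (hv : v ≠ 0) {p : ℕ → ℝ[X]} (hp : ∀ n, (p n).Monic)
    (hd : ∀ n, (p n).natDegree = n) (ho : ∀ m n, m ≠ n → L (p m * p n) = 0) (n : ℕ) :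
    p n = varHermite v n := by
  obtain ⟨Qm, Qd⟩ := varHermite_monic_natDegree v n
  by_contra hne
  set q := p n - varHermite v n with hq
  have hq0 : q ≠ 0 := sub_ne_zero.2 hne
  have hdeg : (p n).degree = (varHermite v n).degree := by
    rw [degree_eq_natDegree (hp n).ne_zero, degree_eq_natDegree Qm.ne_zero, hd, Qd]
  have hlt : q.degree < n := by
    have := degree_sub_lt_left hdeg (hp n).ne_zero
      (by rw [(hp n).leadingCoeff, Qm.leadingCoeff])
    rwa [degree_eq_natDegree (hp n).ne_zero, hd] at this
  have hkn : q.natDegree < n := by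
    rw [degree_eq_natDegree hq0] at hlt; exact_mod_cast hlt
  set k := q.natDegree with hk
  obtain ⟨Rm, Rd⟩ := varHermite_monic_natDegree v k
  have hRlt : (varHermite v k).degree < n := by
    rw [degree_eq_natDegree Rm.ne_zero, Rd]; exact_mod_cast hkn
  have e1 : L (varHermite v k * q) = 0 := by
    have h2 : varHermite v k * q = p n * varHermite v k - varHermite v n * varHermite v k := by
      rw [hq]; ring
    rw [h2, map_sub, functional_mul_eq_zero_of_natDegree_lt hp hd ho n _ hRlt,
      functional_varHermite_mul hL, iterate_derivative_eq_zero (by rw [Rd]; exact hkn)]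
    simp
  have e2 : L (varHermite v k * q) = v ^ k * (q.leadingCoeff * k !) := by
    rw [functional_varHermite_mul hL]
    have hd0 : (derivative^[k] q).natDegree = 0 := by
      have := natDegree_iterate_derivative q k
      omega
    rw [eq_C_of_natDegree_eq_zero hd0, coeff_iterate_derivative, zero_add,
      Nat.descFactorial_self, nsmul_eq_mul]
    have : ∀ a : ℝ, L (C a) = a := by
      intro a
      have := L.map_smul a 1
      rwa [smul_eq_C_mul, mul_one, h1, smul_eq_mul, mul_one] at this
    rw [this, mul_comm (k ! : ℝ)]; rfl
  rw [e1] at e2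
  have : v ^ k * (q.leadingCoeff * k !) ≠ 0 :=
    mul_ne_zero (pow_ne_zero _ hv) (mul_ne_zero (leadingCoeff_ne_zero.2 hq0)
      (Nat.cast_ne_zero.2 (Nat.factorial_ne_zero _)))
  exact this e2.symm

theorem functional_varHermite_sq (hL : ∀ q, L (X * q) = v * L (derivative q)) (h1 : L 1 = 1)
    (n : ℕ) : L (varHermite v n * varHermite v n) = v ^ n * n ! := by
  obtain ⟨Qm, Qd⟩ := varHermite_monic_natDegree v n
  rw [functional_varHermite_mul hL, iterate_derivative_of_monic Qm Qd]
  have := L.map_smul (n ! : ℝ) 1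
  rw [smul_eq_C_mul, mul_one, h1, smul_eq_mul, mul_one] at this
  rw [this]

end Functional

end

noncomputable section

/-! ### Random variables with moments of all orders -/

/-- `f` belongs to `L^q` for every finite `q`. -/
def HasAllMoments {Ω : Type*} [MeasurableSpace Ω] (f : Ω → ℝ) (P : Measure Ω) : Prop :=
  ∀ q : ℝ≥0∞, q ≠ ∞ → MemLp f q P

namespace HasAllMoments

variable {Ω : Type*} [MeasurableSpace Ω] {P : Measure Ω} {f g : Ω → ℝ}

theorem of_integrable_abs_pow [IsFiniteMeasure P] (hm : AEStronglyMeasurable f P)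
    (h : ∀ n : ℕ, Integrable (fun ω => |f ω| ^ n) P) : HasAllMoments f P := by
  intro q hq
  obtain ⟨n, hn⟩ := ENNReal.exists_nat_gt hq
  have hn0 : (n : ℝ≥0∞) ≠ 0 := (pos_of_gt hn).ne'
  refine MemLp.mono_exponent (q := n) ?_ hn.le
  rw [← integrable_norm_rpow_iff hm hn0 (by simp)]
  simpa using h n

theorem integrable (hf : HasAllMoments f P) : Integrable f P :=
  memLp_one_iff_integrable.1 (hf 1 (by simp))

theorem memLp_two (hf : HasAllMoments f P) : MemLp f 2 P := hf 2 (by simp)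

theorem add (hf : HasAllMoments f P) (hg : HasAllMoments g P) :
    HasAllMoments (fun ω => f ω + g ω) P := fun q hq => (hf q hq).add (hg q hq)

theorem sub (hf : HasAllMoments f P) (hg : HasAllMoments g P) :
    HasAllMoments (fun ω => f ω - g ω) P := fun q hq => (hf q hq).sub (hg q hq)

theorem const_mul (hf : HasAllMoments f P) (c : ℝ) :
    HasAllMoments (fun ω => c * f ω) P := fun q hq => (hf q hq).const_mul c

theorem const [IsFiniteMeasure P] (c : ℝ) : HasAllMoments (fun _ : Ω => c) P :=
  fun _ _ => memLp_const c

theorem mul (hf : HasAllMoments f P) (hg : HasAllMoments g P) :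
    HasAllMoments (fun ω => f ω * g ω) P := by
  intro q hq
  have h2 : 2 * q ≠ ∞ := ENNReal.mul_ne_top (by simp) hq
  have : ENNReal.HolderTriple (2 * q) (2 * q) q := ⟨by
    rw [ENNReal.mul_inv (by simp) (by simp), ← add_mul, ENNReal.inv_two_add_inv_two, one_mul]⟩
  exact (hg _ h2).mul' (hf _ h2)

theorem pow [IsFiniteMeasure P] (hf : HasAllMoments f P) (n : ℕ) :
    HasAllMoments (fun ω => f ω ^ n) P := by
  induction n with
  | zero => simpa using const 1
  | succ n ih => simpa [pow_succ] using ih.mul hf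

theorem polynomial_eval [IsFiniteMeasure P] (hf : HasAllMoments f P) (q : ℝ[X]) :
    HasAllMoments (fun ω => q.eval (f ω)) P := by
  induction q using Polynomial.induction_on' with
  | add p q hp hq => simpa using hp.add hq
  | monomial n a => simpa using (hf.pow n).const_mul a

end HasAllMoments

/-! ### Linear algebra of the regression matrices -/

theorem coeffMatrix_det {p : ℕ → ℝ[X]} (hp : ∀ n, (p n).Monic) (hd : ∀ n, (p n).natDegree = n)
    (n : ℕ) : (coeffMatrix p n).det = 1 := by
  rw [Matrix.det_of_isLowerTriangular]
  · refine Finset.prod_eq_one fun i _ => ?_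
    have := (hp i).coeff_natDegree
    rw [hd] at this
    simpa [coeffMatrix] using this
  · intro i j hij
    have : (i : ℕ) < j := by simpa using hij
    simp [coeffMatrix, coeff_eq_zero_of_natDegree_lt, hd, this]

/-- The coefficient vector of p_n is a left eigenvector of the regression matrix: this is the last
row of the identity V⁻¹ A = Λ V⁻¹. -/
theorem regression_eval {γ : ℕ → ℕ → ℝ → ℝ} {α : ℕ → ℝ} {p : ℕ → ℝ[X]}
    (hp : ∀ n, (p n).Monic) (hd : ∀ n, (p n).natDegree = n) {n : ℕ} {t : ℝ}
    (h : regressionMatrix γ n t = (coeffMatrix p n)⁻¹ *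
        Matrix.diagonal (fun i : Fin (n + 1) => Real.exp (-α i * t)) * coeffMatrix p n) (x : ℝ) :
    ∑ i ∈ Finset.range (n + 1), (p n).coeff i * ∑ j ∈ Finset.range (i + 1), γ i j t * x ^ j =
      Real.exp (-α n * t) * (p n).eval x := by
  have hu : IsUnit (coeffMatrix p n).det := by rw [coeffMatrix_det hp hd]; exact isUnit_one
  have hCA : coeffMatrix p n * regressionMatrix γ n t =
      Matrix.diagonal (fun i : Fin (n + 1) => Real.exp (-α i * t)) * coeffMatrix p n := by
    rw [h, Matrix.mul_assoc, Matrix.mul_nonsing_inv_cancel_left _ _ hu]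
  have hrow : ∀ j : Fin (n + 1), ∑ i : Fin (n + 1), (p n).coeff i * regressionMatrix γ n t i j =
      Real.exp (-α n * t) * (p n).coeff j := by
    intro j
    have := congrFun (congrFun hCA (Fin.last n)) j
    rw [Matrix.mul_apply, Matrix.diagonal_mul] at this
    simpa [coeffMatrix] using this
  -- Padding with the zeros above the diagonal gives all rows the same length, so that the two sums
  -- can be exchanged.
  have hin : ∀ i ∈ Finset.range (n + 1), ∑ j ∈ Finset.range (i + 1), γ i j t * x ^ j =
      ∑ j ∈ Finset.range (n + 1), (if j ≤ i then γ i j t else 0) * x ^ j := by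
    intro i hi
    have hi' := Finset.mem_range.1 hi
    rw [← Finset.sum_subset (Finset.range_mono (show i + 1 ≤ n + 1 by omega))]
    · refine Finset.sum_congr rfl fun j hj => ?_
      rw [if_pos (by have := Finset.mem_range.1 hj; omega)]
    · intro j _ hj
      rw [if_neg (by simpa using hj), zero_mul]
  rw [Finset.sum_congr rfl fun i hi => by rw [hin i hi, Finset.mul_sum], Finset.sum_comm,
    eval_eq_sum_range, hd, Finset.mul_sum, Finset.sum_range, Finset.sum_range]
  refine Finset.sum_congr rfl fun j _ => ?_
  rw [← mul_assoc, ← hrow j, Finset.sum_mul, Finset.sum_range]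
  refine Finset.sum_congr rfl fun i _ => ?_
  simp [regressionMatrix, mul_assoc]

theorem monic_sequence_induction {p : ℕ → ℝ[X]} (hp : ∀ n, (p n).Monic)
    (hd : ∀ n, (p n).natDegree = n) {M : ℝ[X] → Prop} (h0 : M 0) (hs : ∀ n, M (p n))
    (ha : ∀ f g, M f → M g → M (f + g)) (hc : ∀ (a : ℝ) f, M f → M (a • f)) (q : ℝ[X]) : M q := by
  let S : Polynomial.Sequence ℝ :=
    { elems' := p, degree_eq' := fun i => by rw [degree_eq_natDegree (hp i).ne_zero, hd] }
  have hspan : Submodule.span ℝ (Set.range p) = ⊤ :=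
    S.span fun i => by
      have : (S i).leadingCoeff = 1 := (hp i).leadingCoeff
      rw [this]; exact isUnit_one
  have hq : q ∈ Submodule.span ℝ (Set.range p) := hspan ▸ Submodule.mem_top
  induction hq using Submodule.span_induction with
  | mem x hx => obtain ⟨n, rfl⟩ := hx; exact hs n
  | zero => exact h0
  | add f g _ _ hf hg => exact ha f g hf hg
  | smul a f _ hf => exact hc a f hf

/-! ### The natural filtration -/

section Past

variable {Ω ι : Type*} [LinearOrder ι] {Z : ι → Ω → ℝ}

theorem pastSigma_le [mΩ : MeasurableSpace Ω] (hZ : ∀ t, Measurable (Z t)) (s : ι) : pastSigma Z s ≤ mΩ :=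
  iSup₂_le fun r _ => (hZ r).comap_le

theorem comap_le_pastSigma {r s : ι} (h : r ≤ s) :
    MeasurableSpace.comap (Z r) inferInstance ≤ pastSigma Z s :=
  le_iSup₂_of_le (f := fun r (_ : r ∈ Set.Iic s) => MeasurableSpace.comap (Z r) inferInstance)
    r h le_rfl

theorem measurable_pastSigma {r s : ι} (h : r ≤ s) : Measurable[pastSigma Z s] (Z r) :=
  (comap_measurable (Z r)).mono (comap_le_pastSigma h) le_rfl

end Past

/-- Pull-out property for expectations. -/
theorem integral_mul_eq_of_condExp {Ω : Type*} {m mΩ : MeasurableSpace Ω} {P : Measure Ω}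
    [IsProbabilityMeasure P] (hm : m ≤ mΩ) {f g k : Ω → ℝ} (hg : Measurable[m] g)
    (hf : Integrable f P) (hfg : Integrable (fun ω => f ω * g ω) P) (hk : P[f | m] =ᵐ[P] k) :
    ∫ ω, f ω * g ω ∂P = ∫ ω, k ω * g ω ∂P := by
  have h := condExp_mul_of_stronglyMeasurable_right (m := m) (μ := P) hg.stronglyMeasurable hfg hf
  rw [← integral_condExp hm]
  refine integral_congr_ae ?_
  filter_upwards [h, hk] with ω h1 h2
  have h1' : (P[fun ω => f ω * g ω | m]) ω = (P[f | m]) ω * g ω := h1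
  rw [h1', h2]

end

noncomputable section

variable {Ω : Type*} [MeasurableSpace Ω] {P : Measure Ω} [IsProbabilityMeasure P]
  {X : ℝ → Ω → ℝ} {γ : ℕ → ℕ → ℝ → ℝ} {α : ℕ → ℝ} {p : ℕ → ℝ[X]} {δ : ℕ → ℝ} {r : ℝ}

/-! ### Stationary processes with polynomial regression -/

namespace IsSMPR

omit [IsProbabilityMeasure P] in
theorem measurable (hX : IsSMPR X P γ α p) (t : ℝ) : Measurable (X t) :=
  hX.stationaryMarkov.markov.1 t

theorem hasAllMoments (hX : IsSMPR X P γ α p) (t : ℝ) : HasAllMoments (X t) P :=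
  .of_integrable_abs_pow (hX.measurable t).aestronglyMeasurable fun n => hX.moments n t

omit [IsProbabilityMeasure P] in
theorem integral_comp (hX : IsSMPR X P γ α p) {f : ℝ → ℝ} (hf : Measurable f) (t : ℝ) :
    ∫ ω, f (X t ω) ∂P = ∫ ω, f (X 0 ω) ∂P := by
  rw [← integral_map (hX.measurable t).aemeasurable hf.aestronglyMeasurable,
    hX.stationaryMarkov.marginal t,
    integral_map (hX.measurable 0).aemeasurable hf.aestronglyMeasurable]

/-- The probabilistic form of the diagonalization: exp(α_n t) p_n(X_t) is a martingale. -/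
theorem condExp_eval (hX : IsSMPR X P γ α p) (n : ℕ) {s t : ℝ} (hst : s < t) :
    P[fun ω => (p n).eval (X t ω) | pastSigma X s] =ᵐ[P]
      fun ω => Real.exp (-α n * (t - s)) * (p n).eval (X s ω) := by
  have h1 : (fun ω => (p n).eval (X t ω)) =
      ∑ i ∈ Finset.range (n + 1), (p n).coeff i • fun ω => X t ω ^ i := by
    ext ω
    rw [eval_eq_sum_range, hX.natDegree]
    simp
  have h2 := condExp_finsetSum (μ := P) (s := Finset.range (n + 1))
    (f := fun i => (p n).coeff i • fun ω => X t ω ^ i)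
    (fun i _ => (((hX.hasAllMoments t).pow i).integrable).smul _) (pastSigma X s)
  rw [h1]
  refine h2.trans ?_
  have h3 : ∀ i : ℕ, P[(p n).coeff i • (fun ω => X t ω ^ i) | pastSigma X s] =ᵐ[P]
      fun ω => (p n).coeff i * ∑ j ∈ Finset.range (i + 1), γ i j (t - s) * X s ω ^ j := by
    intro i
    filter_upwards [condExp_smul (μ := P) ((p n).coeff i) (fun ω => X t ω ^ i) (pastSigma X s),
      hX.regression i s t hst] with ω ha hb
    rw [ha, Pi.smul_apply, hb, smul_eq_mul]
  filter_upwards [ae_all_iff.2 h3] with ω h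
  rw [Finset.sum_apply, Finset.sum_congr rfl fun i _ => h i,
    regression_eval hX.monic hX.natDegree (hX.diagonalization n (t - s) (sub_pos.2 hst))]

theorem integral_eval_mul (hX : IsSMPR X P γ α p) (n : ℕ) (q : ℝ[X]) {s t : ℝ} (hst : s < t) :
    ∫ ω, (p n).eval (X t ω) * q.eval (X s ω) ∂P =
      Real.exp (-α n * (t - s)) * ∫ ω, (p n).eval (X 0 ω) * q.eval (X 0 ω) ∂P := by
  rw [integral_mul_eq_of_condExp (pastSigma_le hX.measurable s)
    (g := fun ω => q.eval (X s ω)) (q.continuous.measurable.comp (measurable_pastSigma le_rfl))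
    ((hX.hasAllMoments t).polynomial_eval _).integrable
    (((hX.hasAllMoments t).polynomial_eval _).mul
      ((hX.hasAllMoments s).polynomial_eval _)).integrable (hX.condExp_eval n hst)]
  simp_rw [mul_assoc]
  rw [integral_const_mul,
    hX.integral_comp (f := fun x => (p n).eval x * q.eval x) (by fun_prop) s]

end IsSMPR

/-! ### Regularity and reversibility against linear functions -/

namespace IsRSMPR

omit [IsProbabilityMeasure P] in
theorem integral_eval_mul_eval (hX : IsRSMPR X P γ α p) {m n : ℕ} (h : m ≠ n) :
    ∫ ω, (p m).eval (X 0 ω) * (p n).eval (X 0 ω) ∂P = 0 := by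
  have h' := hX.orthogonal m n h
  rwa [integral_map (hX.measurable 0).aemeasurable] at h'
  exact (by fun_prop : Measurable fun x => (p m).eval x * (p n).eval x).aestronglyMeasurable

theorem p_one_eq_X (hX : IsRSMPR X P γ α p) (h0 : ∫ ω, X 0 ω ∂P = 0) : p 1 = Polynomial.X := by
  have hp0 : p 0 = 1 := by
    have := hX.monic 0
    exact eq_one_of_monic_natDegree_zero this (hX.natDegree 0)
  have h := hX.integral_eval_mul_eval (m := 1) (n := 0) (by simp)
  have hp1 : p 1 = Polynomial.X + C ((p 1).coeff 0) := by
    conv_lhs => rw [eq_X_add_C_of_natDegree_le_one (hX.natDegree 1).le]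
    have : (p 1).coeff 1 = 1 := by
      have := (hX.monic 1).coeff_natDegree
      rwa [hX.natDegree] at this
    rw [this]; simp
  rw [hp1, hp0] at h
  simp only [eval_add, eval_X, eval_C, eval_one, mul_one] at h
  rw [integral_add (hX.hasAllMoments 0).integrable (integrable_const _), h0] at h
  simp at h
  rw [hp1, h]; simp

/-- Time reversibility tested against linear functions. -/
theorem integral_eval_mul_past (hX : IsRSMPR X P γ α p) (h0 : ∫ ω, X 0 ω ∂P = 0) {s t : ℝ}
    (hst : s < t) (f : ℝ[X]) :
    ∫ ω, f.eval (X t ω) * X s ω ∂P =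
      Real.exp (-α 1 * (t - s)) * ∫ ω, f.eval (X 0 ω) * X 0 ω ∂P := by
  have hp1 := hX.p_one_eq_X h0
  have hint : ∀ (g : ℝ[X]) (u v : ℝ), Integrable (fun ω => g.eval (X u ω) * X v ω) P :=
    fun g u v => (((hX.hasAllMoments u).polynomial_eval g).mul (hX.hasAllMoments v)).integrable
  induction f using monic_sequence_induction hX.monic hX.natDegree with
  | h0 => simp
  | hs n =>
    have h := hX.integral_eval_mul n Polynomial.X hst
    simp only [eval_X] at h
    rw [h]
    -- Testing p_n produces the factor exp(-α_n(t-s)), but for n ≠ 1 both sides vanish since p_n is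
    -- orthogonal to p_1 = x. Hence only the rate α_1 is seen.
    by_cases hn : n = 1
    · rw [hn]
    · have h' := hX.integral_eval_mul_eval hn
      rw [hp1] at h'
      simp only [eval_X] at h'
      rw [h', mul_zero, mul_zero]
  | ha f g hf hg =>
    simp only [eval_add, add_mul]
    rw [integral_add (hint f t s) (hint g t s), integral_add (hint f 0 0) (hint g 0 0), hf, hg]
    ring
  | hc a f hf =>
    simp only [eval_smul, smul_eq_mul, mul_assoc]
    rw [integral_const_mul, integral_const_mul, hf]
    ring

end IsRSMPR

/-! ### Covariances and the sign of the first correlation index -/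

namespace IsDeltaRSMPRIR

theorem integral_mul (hX : IsDeltaRSMPRIR X P γ α p δ r) {s t : ℝ} (hst : s ≤ t) :
    ∫ ω, X t ω * X s ω ∂P = Real.exp (-α 1 * (t - s)) * ∫ ω, X 0 ω ^ 2 ∂P := by
  rcases hst.lt_or_eq with h | rfl
  · simpa [← pow_two] using hX.integral_eval_mul_past hX.centred h Polynomial.X
  · simpa [← pow_two] using hX.integral_comp (f := fun x => x ^ 2) (by fun_prop) s

omit [IsProbabilityMeasure P] in
theorem integral_eq_zero (hX : IsDeltaRSMPRIR X P γ α p δ r) (t : ℝ) : ∫ ω, X t ω ∂P = 0 :=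
  (hX.integral_comp measurable_id t).trans hX.centred

theorem covariance_eq (hX : IsDeltaRSMPRIR X P γ α p δ r) (s t : ℝ) :
    covariance (X s) (X t) P = (∫ ω, X 0 ω ^ 2 ∂P) * Real.exp (-α 1 * |t - s|) := by
  rw [covariance_eq_sub (hX.hasAllMoments s).memLp_two (hX.hasAllMoments t).memLp_two,
    hX.integral_eq_zero, zero_mul, sub_zero]
  rcases le_total s t with h | h
  · rw [abs_of_nonneg (sub_nonneg.2 h), mul_comm (∫ ω, X 0 ω ^ 2 ∂P), ← hX.integral_mul h]
    exact integral_congr_ae (ae_of_all _ fun ω => mul_comm _ _)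
  · rw [abs_of_nonpos (sub_nonpos.2 h), neg_sub, mul_comm (∫ ω, X 0 ω ^ 2 ∂P),
      ← hX.integral_mul h]
    rfl

theorem integral_sq_pos (hX : IsDeltaRSMPRIR X P γ α p δ r) : 0 < ∫ ω, X 0 ω ^ 2 ∂P := by
  refine lt_of_le_of_ne (integral_nonneg fun ω => sq_nonneg _) fun h => ?_
  refine hX.tld 1 (fun _ => 0) (Function.injective_of_subsingleton _) ?_
  simp [hX.covariance_eq, ← h]

/-- Nonsingularity of the covariance matrix at times 0 and 1 excludes α_1 = 0. A negative value is
excluded by 0 ≤ E(X_1 - ρX_0)² = (1 - ρ²) E X_0² with ρ = exp(-α_1). -/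
theorem alpha_one_pos (hX : IsDeltaRSMPRIR X P γ α p δ r) : 0 < α 1 := by
  have hv := hX.integral_sq_pos
  have h2 := hX.tld 2 ![0, 1] (by
    intro i j; fin_cases i <;> fin_cases j <;> simp)
  rw [Matrix.det_fin_two] at h2
  simp only [Matrix.of_apply, hX.covariance_eq] at h2
  simp at h2
  have hne : α 1 ≠ 0 := by
    intro h; rw [h] at h2; simp at h2
  have hsq : 0 ≤ ∫ ω, (X 1 ω - Real.exp (-α 1) * X 0 ω) ^ 2 ∂P :=
    integral_nonneg fun ω => sq_nonneg _
  have hexp : ∫ ω, (X 1 ω - Real.exp (-α 1) * X 0 ω) ^ 2 ∂P =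
      (1 - Real.exp (-α 1) ^ 2) * ∫ ω, X 0 ω ^ 2 ∂P := by
    have e : ∀ ω, (X 1 ω - Real.exp (-α 1) * X 0 ω) ^ 2 =
        X 1 ω * X 1 ω - 2 * Real.exp (-α 1) * (X 1 ω * X 0 ω) +
          Real.exp (-α 1) ^ 2 * (X 0 ω * X 0 ω) := fun ω => by ring
    have i : ∀ s t, Integrable (fun ω => X s ω * X t ω) P := fun s t =>
      ((hX.hasAllMoments s).mul (hX.hasAllMoments t)).integrable
    simp_rw [e]
    have i1 := (i 1 0).const_mul (2 * Real.exp (-α 1))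
    have i2 : Integrable (fun ω => X 1 ω * X 1 ω - 2 * Real.exp (-α 1) * (X 1 ω * X 0 ω)) P :=
      (i 1 1).sub i1
    rw [integral_add i2 ((i 0 0).const_mul _), integral_sub (i 1 1) i1, integral_const_mul, integral_const_mul,
      hX.integral_mul le_rfl, hX.integral_mul le_rfl, hX.integral_mul zero_le_one]
    simp
    ring
  rw [hexp] at hsq
  have h3 : 0 ≤ 1 - Real.exp (-α 1) ^ 2 := nonneg_of_mul_nonneg_left hsq hv
  have h4 : Real.exp (-α 1) ≤ 1 := by
    have := Real.exp_pos (-α 1)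
    nlinarith
  rw [Real.exp_le_one_iff] at h4
  exact lt_of_le_of_ne (by linarith) hne.symm

/-! ### The innovations `X_t - ρ X_s` -/

theorem condExp_eq (hX : IsDeltaRSMPRIR X P γ α p δ r) {s t : ℝ} (hst : s < t) :
    P[X t | pastSigma X s] =ᵐ[P] fun ω => Real.exp (-α 1 * (t - s)) * X s ω := by
  have h := hX.condExp_eval 1 hst
  rw [hX.p_one_eq_X hX.centred] at h
  simpa using h

theorem hasAllMoments_innovation (hX : IsDeltaRSMPRIR X P γ α p δ r) (s t ρ : ℝ) :
    HasAllMoments (fun ω => X t ω - ρ * X s ω) P :=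
  (hX.hasAllMoments t).sub ((hX.hasAllMoments s).const_mul _)

theorem condExp_innovation_pow (hX : IsDeltaRSMPRIR X P γ α p δ r) {s t : ℝ} (hst : s < t)
    (j : ℕ) :
    P[fun ω => (X t ω - Real.exp (-α 1 * (t - s)) * X s ω) ^ j | pastSigma X s] =ᵐ[P]
      fun _ => ∫ ω, (X t ω - Real.exp (-α 1 * (t - s)) * X s ω) ^ j ∂P := by
  rcases Nat.eq_zero_or_pos j with rfl | hj
  · simp only [pow_zero]
    rw [condExp_const (pastSigma_le hX.measurable s)]
    simp
  obtain ⟨c, hc⟩ := hX.indepRegression s t hst j hj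
  have h1 : (fun ω => (X t ω - (P[X t | pastSigma X s]) ω) ^ j) =ᵐ[P]
      fun ω => (X t ω - Real.exp (-α 1 * (t - s)) * X s ω) ^ j := by
    filter_upwards [hX.condExp_eq hst] with ω h
    rw [h]
  have h2 := (condExp_congr_ae (m := pastSigma X s) h1).symm.trans hc
  have h3 : ∫ ω, (X t ω - Real.exp (-α 1 * (t - s)) * X s ω) ^ j ∂P = c := by
    rw [← integral_condExp (pastSigma_le hX.measurable s), integral_congr_ae h2]
    simp
  rw [h3]
  exact h2

theorem integral_innovation_pow_mul (hX : IsDeltaRSMPRIR X P γ α p δ r) {s t : ℝ} (hst : s < t)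
    (j k : ℕ) :
    ∫ ω, (X t ω - Real.exp (-α 1 * (t - s)) * X s ω) ^ j * X s ω ^ k ∂P =
      (∫ ω, (X t ω - Real.exp (-α 1 * (t - s)) * X s ω) ^ j ∂P) * ∫ ω, X 0 ω ^ k ∂P := by
  have hD := (hX.hasAllMoments_innovation s t (Real.exp (-α 1 * (t - s)))).pow j
  rw [integral_mul_eq_of_condExp (pastSigma_le hX.measurable s)
    ((measurable_pastSigma le_rfl).pow_const k) hD.integrable
    (hD.mul ((hX.hasAllMoments s).pow k)).integrable (hX.condExp_innovation_pow hst j),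
    integral_const_mul, hX.integral_comp (f := fun x => x ^ k) (by fun_prop) s]

/-- Binomial expansion of X_t = ρX_s + D, with mixed moments factored. The left side is known
independently for l = 0 (stationarity) and l = 1 (reversibility), which yields the two moment
relations. -/
theorem integral_pow_mul_pow (hX : IsDeltaRSMPRIR X P γ α p δ r) {s t : ℝ} (hst : s < t)
    (n l : ℕ) :
    ∫ ω, X t ω ^ n * X s ω ^ l ∂P = ∑ k ∈ Finset.range (n + 1),
      (n.choose k : ℝ) * Real.exp (-α 1 * (t - s)) ^ k * (∫ ω, X 0 ω ^ (k + l) ∂P) *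
        ∫ ω, (X t ω - Real.exp (-α 1 * (t - s)) * X s ω) ^ (n - k) ∂P := by
  set ρ := Real.exp (-α 1 * (t - s)) with hρ
  have e : ∀ ω, X t ω ^ n * X s ω ^ l = ∑ k ∈ Finset.range (n + 1),
      ((n.choose k : ℝ) * ρ ^ k) * ((X t ω - ρ * X s ω) ^ (n - k) * X s ω ^ (k + l)) := by
    intro ω
    have h := add_pow (ρ * X s ω) (X t ω - ρ * X s ω) n
    rw [add_sub_cancel] at h
    rw [h, Finset.sum_mul]
    refine Finset.sum_congr rfl fun k _ => ?_
    rw [mul_pow, pow_add]; ring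
  simp_rw [e]
  rw [integral_finsetSum]
  · refine Finset.sum_congr rfl fun k _ => ?_
    rw [integral_const_mul, hX.integral_innovation_pow_mul hst]
    ring
  · intro k _
    exact ((((hX.hasAllMoments_innovation s t ρ).pow _).mul
      ((hX.hasAllMoments s).pow _)).const_mul _).integrable

/-- The moments of the stationary law and of the innovations satisfy the Gaussian recurrence. -/
theorem moments_recurrence (hX : IsDeltaRSMPRIR X P γ α p δ r) {s t : ℝ} (hst : s < t) :
    (∀ j : ℕ, ∫ ω, X 0 ω ^ (j + 2) ∂P =
      (j + 1) * (∫ ω, X 0 ω ^ 2 ∂P) * ∫ ω, X 0 ω ^ j ∂P) ∧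
    ∀ j : ℕ, ∫ ω, (X t ω - Real.exp (-α 1 * (t - s)) * X s ω) ^ (j + 2) ∂P =
      (j + 1) * ((1 - Real.exp (-α 1 * (t - s)) ^ 2) * ∫ ω, X 0 ω ^ 2 ∂P) *
        ∫ ω, (X t ω - Real.exp (-α 1 * (t - s)) * X s ω) ^ j ∂P := by
  set ρ := Real.exp (-α 1 * (t - s)) with hρ
  have hρ1 : ρ < 1 := by
    rw [hρ, Real.exp_lt_one_iff]
    have := mul_pos hX.alpha_one_pos (sub_pos.2 hst)
    linarith
  set m : ℕ → ℝ := fun n => ∫ ω, X 0 ω ^ n ∂P with hm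
  set c : ℕ → ℝ := fun n => ∫ ω, (X t ω - ρ * X s ω) ^ n ∂P with hc
  have hA : ∀ n, m n =
      ∑ k ∈ Finset.range (n + 1), (n.choose k : ℝ) * ρ ^ k * m k * c (n - k) := by
    intro n
    have h := hX.integral_pow_mul_pow hst n 0
    simp only [pow_zero, mul_one, add_zero] at h
    rw [← h]
    exact (hX.integral_comp (f := fun x => x ^ n) (by fun_prop) t).symm
  have hB : ∀ n, ρ * m (n + 1) =
      ∑ k ∈ Finset.range (n + 1), (n.choose k : ℝ) * ρ ^ k * m (k + 1) * c (n - k) := by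
    intro n
    have h := hX.integral_pow_mul_pow hst n 1
    have h' := hX.integral_eval_mul_past hX.centred hst (Polynomial.X ^ n)
    simp only [eval_pow, eval_X, ← pow_succ] at h'
    simp only [pow_one] at h
    rw [← h, h']
  have m0 : m 0 = 1 := by simp [hm]
  have m1 : m 1 = 0 := by simpa [hm] using hX.centred
  have c0 : c 0 = 1 := by simp [hc]
  have c1 : c 1 = 0 := by
    have h := hA 1
    simp [Finset.sum_range_succ, m0, m1, c0] at h
    exact h.symm
  have hm' := moment_recurrence (Real.exp_pos _) hρ1 m0 m1 rfl c0 hA hB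
  exact ⟨hm', innovation_recurrence m0 c1 hA hB hm'⟩

/-- The variance of the stationary law. -/
def _root_.stationaryVar {Ω : Type*} [MeasurableSpace Ω] (X : ℝ → Ω → ℝ) (P : Measure Ω) : ℝ≥0 :=
  ⟨∫ ω, X 0 ω ^ 2 ∂P, integral_nonneg fun _ => sq_nonneg _⟩

theorem map_zero_eq (hX : IsDeltaRSMPRIR X P γ α p δ r) :
    P.map (X 0) = gaussianReal 0 (stationaryVar X P) := by
  refine (hX.determinate.2 _ inferInstance (integrable_pow_gaussianReal _) fun n => ?_).symm
  rw [integral_map (hX.measurable 0).aemeasurable (by fun_prop)]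
  refine eq_of_two_step (a := fun n => ∫ x, x ^ n ∂gaussianReal 0 (stationaryVar X P))
    (b := fun n => ∫ ω, X 0 ω ^ n ∂P) (w := ∫ ω, X 0 ω ^ 2 ∂P) ?_ ?_
    (integral_pow_add_two_gaussianReal _) (hX.moments_recurrence zero_lt_one).1 n
  · simp
  · simp [hX.centred]

theorem map_eq (hX : IsDeltaRSMPRIR X P γ α p δ r) (t : ℝ) :
    P.map (X t) = gaussianReal 0 (stationaryVar X P) :=
  (hX.stationaryMarkov.marginal t).trans hX.map_zero_eq

end IsDeltaRSMPRIR

end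

noncomputable section

/-! ### Independence criteria -/

/-- `Z` is independent of `m` if its conditional law is the same on all events of `m`. -/
theorem indep_comap_of_cond_map_eq {Ω : Type*} {m mΩ : MeasurableSpace Ω} {P : Measure Ω}
    [IsProbabilityMeasure P] (hm : m ≤ mΩ) {Z : Ω → ℝ} (hZ : Measurable Z) {ν : Measure ℝ}
    (h : ∀ A, MeasurableSet[m] A → P A ≠ 0 → (cond P A).map Z = ν) :
    Indep m (MeasurableSpace.comap Z inferInstance) P := by
  rw [Indep_iff]
  rintro A _ hA ⟨B, hB, rfl⟩
  have hmap : ∀ A, MeasurableSet[m] A → P A ≠ 0 → P (A ∩ Z ⁻¹' B) = P A * ν B := by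
    intro A hA h0
    rw [← h A hA h0, Measure.map_apply hZ hB, cond_apply (hm _ hA), ← mul_assoc,
      ENNReal.mul_inv_cancel h0 (measure_ne_top _ _), one_mul]
  have hν := hmap Set.univ MeasurableSet.univ (by simp)
  rw [Set.univ_inter, measure_univ, one_mul] at hν
  by_cases h0 : P A = 0
  · rw [h0, zero_mul]
    exact measure_mono_null Set.inter_subset_left h0
  · rw [hmap A hA h0, hν]

/-- If every increment is independent of the past, the increments are jointly independent. -/
theorem hasIndepIncrements_of_indep_past {Ω ι : Type*} [MeasurableSpace Ω] [LinearOrder ι]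
    {P : Measure Ω} [IsProbabilityMeasure P] {Z : ι → Ω → ℝ}
    (h : ∀ s t, s ≤ t → Indep (pastSigma Z s)
      (MeasurableSpace.comap (fun ω => Z t ω - Z s ω) inferInstance) P) :
    HasIndepIncrements Z P := by
  refine HasIndepIncrements.of_nat fun t ht _ => ?_
  rw [iIndepFun_iff_measure_inter_preimage_eq_mul]
  intro S
  -- Peeling off the largest index n leaves an intersection of events about earlier increments, all
  -- of which belong to the past of `t n`.
  induction S using Finset.induction_on_max with
  | empty => simp
  | insert n S hn ih =>
    intro sets hs
    have hnS : n ∉ S := fun h => lt_irrefl _ (hn n h)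
    rw [Finset.set_biInter_insert, Finset.prod_insert hnS, Set.inter_comm, mul_comm,
      ← ih fun i hi => hs i (Finset.mem_insert_of_mem hi)]
    refine (Indep_iff _ _ _).1 (h (t n) (t (n + 1)) (ht n.le_succ)) _ _ ?_
      ⟨_, hs n (Finset.mem_insert_self _ _), rfl⟩
    refine Finset.measurableSet_biInter (m := pastSigma Z (t n)) S fun i hi => ?_
    have hin := hn i hi
    exact ((measurable_pastSigma (ht hin)).sub (measurable_pastSigma (ht hin.le)))
      (hs i (Finset.mem_insert_of_mem hi))

/-! ### Independence of the innovations from the past -/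

namespace IsDeltaRSMPRIR

variable {Ω : Type*} [MeasurableSpace Ω] {P : Measure Ω} [IsProbabilityMeasure P]
  {X : ℝ → Ω → ℝ} {γ : ℕ → ℕ → ℝ → ℝ} {α : ℕ → ℝ} {p : ℕ → ℝ[X]} {δ : ℕ → ℝ} {r : ℝ}

theorem setIntegral_innovation_pow (hX : IsDeltaRSMPRIR X P γ α p δ r) {s t : ℝ} (hst : s < t)
    {A : Set Ω} (hA : MeasurableSet[pastSigma X s] A) (j : ℕ) :
    ∫ ω in A, (X t ω - Real.exp (-α 1 * (t - s)) * X s ω) ^ j ∂P =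
      P.real A * ∫ ω, (X t ω - Real.exp (-α 1 * (t - s)) * X s ω) ^ j ∂P := by
  have hm := pastSigma_le hX.measurable s
  rw [← setIntegral_condExp hm ((hX.hasAllMoments_innovation s t _).pow j).integrable hA,
    setIntegral_congr_ae (g := fun _ =>
      ∫ ω, (X t ω - Real.exp (-α 1 * (t - s)) * X s ω) ^ j ∂P) (hm _ hA)]
  · simp
  · filter_upwards [hX.condExp_innovation_pow hst j] with ω h _ using h

/-- Normalized innovations have the stationary law, conditionally on any event of the past. -/
theorem cond_map_innovation (hX : IsDeltaRSMPRIR X P γ α p δ r) {s t κ : ℝ} (hst : s < t)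
    (hκ : κ ≠ 0) (hκρ : κ ^ 2 = 1 - Real.exp (-α 1 * (t - s)) ^ 2)
    {A : Set Ω} (hA : MeasurableSet[pastSigma X s] A) (hA0 : P A ≠ 0) :
    (cond P A).map (fun ω => κ⁻¹ * (X t ω - Real.exp (-α 1 * (t - s)) * X s ω)) =
      P.map (X 0) := by
  have hAm := pastSigma_le hX.measurable s _ hA
  have hprob : IsProbabilityMeasure (cond P A) := cond_isProbabilityMeasure hA0
  set D : Ω → ℝ := fun ω => X t ω - Real.exp (-α 1 * (t - s)) * X s ω with hD
  have hDm : Measurable D := (hX.measurable t).sub ((hX.measurable s).const_mul _)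
  have hDall : HasAllMoments D P := hX.hasAllMoments_innovation s t _
  have hZm : Measurable (fun ω => κ⁻¹ * D ω) := hDm.const_mul _
  have hcond : cond P A = (P A)⁻¹ • P.restrict A := rfl
  have hZpow : ∀ n : ℕ, (fun ω => (κ⁻¹ * D ω) ^ n) = fun ω => (κ⁻¹) ^ n * D ω ^ n := by
    intro n; ext ω; rw [mul_pow]
  have hint : ∀ n : ℕ, Integrable (fun ω => (κ⁻¹ * D ω) ^ n) (cond P A) := by
    intro n
    rw [hcond]
    exact (((hDall.const_mul _).pow n).integrable.restrict).smul_measure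
      (ENNReal.inv_ne_top.2 hA0)
  have hpow : ∀ n : ℕ, AEStronglyMeasurable (fun x : ℝ => x ^ n)
      ((cond P A).map fun ω => κ⁻¹ * D ω) := fun n => by fun_prop
  refine hX.determinate.2 _ (Measure.isProbabilityMeasure_map hZm.aemeasurable) (fun n => ?_)
    fun n => ?_
  · rw [integrable_map_measure (hpow n) hZm.aemeasurable]
    exact hint n
  · rw [integral_map hZm.aemeasurable (hpow n),
      integral_map (hX.measurable 0).aemeasurable (by fun_prop)]
    have hmom : ∀ n : ℕ, ∫ ω, (κ⁻¹ * D ω) ^ n ∂(cond P A) = (κ⁻¹) ^ n * ∫ ω, D ω ^ n ∂P := by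
      intro n
      rw [hZpow, integral_const_mul, hcond, integral_smul_measure,
        hX.setIntegral_innovation_pow hst hA, ENNReal.toReal_inv, ← measureReal_def, smul_eq_mul,
        inv_mul_cancel_left₀]
      exact (ENNReal.toReal_ne_zero.2 ⟨hA0, measure_ne_top _ _⟩)
    -- Conditioning on A does not change the moments of D, and dividing by κ turns the variance
    -- parameter (1 - ρ²)v into v. The normalized moments thus obey the recurrence of μ.
    have hrec := hX.moments_recurrence hst
    refine eq_of_two_step (a := fun n => ∫ ω, (κ⁻¹ * D ω) ^ n ∂(cond P A))
      (b := fun n => ∫ ω, X 0 ω ^ n ∂P) (w := ∫ ω, X 0 ω ^ 2 ∂P) ?_ ?_ (fun j => ?_) hrec.1 n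
    · simp
    · have h1 : ∫ ω, D ω ∂P = 0 := by
        rw [hD, integral_sub (hX.hasAllMoments t).integrable
          ((hX.hasAllMoments s).integrable.const_mul _), integral_const_mul,
          hX.integral_eq_zero, hX.integral_eq_zero, mul_zero, sub_zero]
      have := hmom 1
      simp only [pow_one, h1, mul_zero] at this
      simp only [pow_one, this, hX.centred]
    · simp only [hmom]
      have hr : ∫ ω, D ω ^ (j + 2) ∂P =
          (j + 1) * ((1 - Real.exp (-α 1 * (t - s)) ^ 2) * ∫ ω, X 0 ω ^ 2 ∂P) *
            ∫ ω, D ω ^ j ∂P := hrec.2 j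
      have hκ2 : κ⁻¹ ^ 2 * κ ^ 2 = 1 := by
        rw [← mul_pow, inv_mul_cancel₀ hκ, one_pow]
      rw [hr, ← hκρ, pow_add]
      linear_combination (κ⁻¹ ^ j * (j + 1) * (∫ ω, X 0 ω ^ 2 ∂P) * ∫ ω, D ω ^ j ∂P) * hκ2

theorem indep_innovation (hX : IsDeltaRSMPRIR X P γ α p δ r) {s t : ℝ} (hst : s < t) :
    Indep (pastSigma X s) (MeasurableSpace.comap
      (fun ω => X t ω - Real.exp (-α 1 * (t - s)) * X s ω) inferInstance) P := by
  set ρ := Real.exp (-α 1 * (t - s)) with hρ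
  have hρ1 : ρ < 1 := by
    rw [hρ, Real.exp_lt_one_iff]
    have := mul_pos hX.alpha_one_pos (sub_pos.2 hst)
    linarith
  have hpos : 0 < 1 - ρ ^ 2 := by
    have : 0 < ρ := Real.exp_pos _
    nlinarith
  set κ := Real.sqrt (1 - ρ ^ 2) with hκ
  have hκ0 : κ ≠ 0 := (Real.sqrt_pos.2 hpos).ne'
  have hκ2 : κ ^ 2 = 1 - ρ ^ 2 := Real.sq_sqrt hpos.le
  have hDm : Measurable (fun ω => X t ω - ρ * X s ω) :=
    (hX.measurable t).sub ((hX.measurable s).const_mul _)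
  refine indep_of_indep_of_le_right (indep_comap_of_cond_map_eq
    (pastSigma_le hX.measurable s) (hDm.const_mul κ⁻¹) (ν := P.map (X 0))
    fun A hA hA0 => hX.cond_map_innovation hst hκ0 hκ2 hA hA0) ?_
  rw [← measurable_iff_comap_le]
  have h := (comap_measurable (fun ω => κ⁻¹ * (X t ω - ρ * X s ω))).const_mul κ
  simpa [mul_inv_cancel_left₀ hκ0] using h

/-! ### The time-changed process -/

omit [IsProbabilityMeasure P] in
theorem measurable_timeChanged (hX : IsDeltaRSMPRIR X P γ α p δ r) (τ : ℝ≥0) :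
    Measurable (timeChanged X (α 1) τ) :=
  (hX.measurable _).const_mul _

omit [MeasurableSpace Ω] in
theorem _root_.timeChanged_zero (X : ℝ → Ω → ℝ) (a : ℝ) : timeChanged X a 0 = fun _ => 0 := by
  ext ω; simp [timeChanged]

theorem log_div_le (hX : IsDeltaRSMPRIR X P γ α p δ r) {σ τ : ℝ≥0} (hσ : 0 < σ) (h : σ ≤ τ) :
    Real.log σ / (2 * α 1) ≤ Real.log τ / (2 * α 1) := by
  have := hX.alpha_one_pos
  gcongr

theorem log_div_lt (hX : IsDeltaRSMPRIR X P γ α p δ r) {σ τ : ℝ≥0} (hσ : 0 < σ) (h : σ < τ) :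
    Real.log σ / (2 * α 1) < Real.log τ / (2 * α 1) := by
  have := hX.alpha_one_pos
  gcongr

theorem pastSigma_timeChanged_le (hX : IsDeltaRSMPRIR X P γ α p δ r) (σ : ℝ≥0) :
    pastSigma (timeChanged X (α 1)) σ ≤ pastSigma X (Real.log σ / (2 * α 1)) := by
  refine iSup₂_le fun ρ hρ => ?_
  rw [← measurable_iff_comap_le]
  -- Time 0 is separate: `Real.log 0 = 0` points to `X 0`, which need not lie in this past, but the
  -- factor √0 makes the variable constant.
  rcases eq_or_ne ρ 0 with rfl | h0
  · rw [timeChanged_zero]; exact measurable_const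
  · exact (measurable_pastSigma (hX.log_div_le (pos_iff_ne_zero.2 h0) hρ)).const_mul _

omit [MeasurableSpace Ω] in
theorem _root_.pastSigma_timeChanged_zero (X : ℝ → Ω → ℝ) (a : ℝ) :
    pastSigma (timeChanged X a) 0 = ⊥ := by
  refine le_bot_iff.1 (iSup₂_le fun ρ hρ => ?_)
  have : ρ = 0 := le_antisymm hρ zero_le
  rw [this, timeChanged_zero, MeasurableSpace.comap_const]

/-- This is what the time change is designed for: it makes the increment from σ to τ exactly √τ
times an innovation of `X`. -/
theorem sqrt_mul_exp (hX : IsDeltaRSMPRIR X P γ α p δ r) {σ τ : ℝ≥0} (hσ : 0 < σ) (hτ : 0 < τ) :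
    Real.sqrt τ * Real.exp (-α 1 * (Real.log τ / (2 * α 1) - Real.log σ / (2 * α 1))) =
      Real.sqrt σ := by
  have ha := hX.alpha_one_pos.ne'
  have hs : ∀ x : ℝ≥0, 0 < x → Real.sqrt x = Real.exp (Real.log x / 2) := by
    intro x hx
    have hx' : (0 : ℝ) < x := hx
    rw [Real.exp_half, Real.exp_log hx']
  rw [hs τ hτ, hs σ hσ, ← Real.exp_add]
  congr 1
  field_simp
  ring

theorem indep_increment (hX : IsDeltaRSMPRIR X P γ α p δ r) {σ τ : ℝ≥0} (h : σ ≤ τ) :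
    Indep (pastSigma (timeChanged X (α 1)) σ) (MeasurableSpace.comap
      (fun ω => timeChanged X (α 1) τ ω - timeChanged X (α 1) σ ω) inferInstance) P := by
  rcases eq_or_ne σ 0 with rfl | h0
  · rw [pastSigma_timeChanged_zero]
    exact indep_bot_left _
  have hσ : 0 < σ := pos_iff_ne_zero.2 h0
  rcases h.eq_or_lt with rfl | hlt
  · simp only [sub_self, MeasurableSpace.comap_const]
    exact indep_bot_right _
  have hτ : 0 < τ := hσ.trans hlt
  refine indep_of_indep_of_le_left (indep_of_indep_of_le_right
    (hX.indep_innovation (hX.log_div_lt hσ hlt)) ?_) (hX.pastSigma_timeChanged_le σ)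
  rw [← measurable_iff_comap_le]
  convert! (comap_measurable (fun ω => X (Real.log τ / (2 * α 1)) ω -
    Real.exp (-α 1 * (Real.log τ / (2 * α 1) - Real.log σ / (2 * α 1))) *
      X (Real.log σ / (2 * α 1)) ω)).const_mul (Real.sqrt τ) using 1
  ext ω
  rw [mul_sub, ← mul_assoc, hX.sqrt_mul_exp hσ hτ]
  rfl

theorem hasIndepIncrements_timeChanged (hX : IsDeltaRSMPRIR X P γ α p δ r) :
    HasIndepIncrements (timeChanged X (α 1)) P :=
  hasIndepIncrements_of_indep_past fun _ _ h => hX.indep_increment h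

theorem stationaryVar_pos (hX : IsDeltaRSMPRIR X P γ α p δ r) : 0 < stationaryVar X P :=
  hX.integral_sq_pos

/-- The normalized time-changed process is a Brownian motion. -/
theorem isPreBrownianReal (hX : IsDeltaRSMPRIR X P γ α p δ r) :
    IsPreBrownianReal (fun τ ω => (Real.sqrt (stationaryVar X P))⁻¹ * timeChanged X (α 1) τ ω) P := by
  refine HasIndepIncrements.isPreBrownianReal_of_hasLaw (fun τ => ?_)
    (hX.hasIndepIncrements_timeChanged.smul (Real.sqrt (stationaryVar X P))⁻¹)
  have hv : (0 : ℝ) < stationaryVar X P := hX.stationaryVar_pos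
  have hlaw : HasLaw (X (Real.log τ / (2 * α 1))) (gaussianReal 0 (stationaryVar X P)) P :=
    ⟨(hX.measurable _).aemeasurable, hX.map_eq _⟩
  have h := gaussianReal_const_mul hlaw ((Real.sqrt (stationaryVar X P))⁻¹ * Real.sqrt τ)
  convert! h using 1
  · ext ω; simp [timeChanged, mul_assoc]
  · congr 1
    · simp
    · ext
      simp only [NNReal.coe_mul, NNReal.coe_mk, mul_pow, inv_pow, Real.sq_sqrt hv.le,
        Real.sq_sqrt τ.coe_nonneg]
      field_simp

theorem timeChanged_eq (hX : IsDeltaRSMPRIR X P γ α p δ r) :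
    timeChanged X (α 1) = fun τ ω => Real.sqrt (stationaryVar X P) •
      ((Real.sqrt (stationaryVar X P))⁻¹ * timeChanged X (α 1) τ ω) := by
  have hv : (0 : ℝ) < stationaryVar X P := hX.stationaryVar_pos
  ext τ ω
  rw [smul_eq_mul, mul_inv_cancel_left₀ (Real.sqrt_pos.2 hv).ne']

theorem isGaussianProcess_timeChanged (hX : IsDeltaRSMPRIR X P γ α p δ r) :
    IsGaussianProcess (timeChanged X (α 1)) P := by
  rw [hX.timeChanged_eq]
  exact hX.isPreBrownianReal.isGaussianProcess.smul fun _ => Real.sqrt (stationaryVar X P)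

theorem hasLaw_increment (hX : IsDeltaRSMPRIR X P γ α p δ r) {σ τ : ℝ≥0} (h : σ ≤ τ) :
    HasLaw (fun ω => timeChanged X (α 1) τ ω - timeChanged X (α 1) σ ω)
      (gaussianReal 0 (stationaryVar X P * (τ - σ))) P := by
  have hv : (0 : ℝ) < stationaryVar X P := hX.stationaryVar_pos
  have h1 := gaussianReal_const_mul (hX.isPreBrownianReal.hasLaw_sub τ σ)
    (Real.sqrt (stationaryVar X P))
  convert! h1 using 1
  · ext ω
    simp only [Pi.sub_apply]
    rw [← mul_sub, mul_inv_cancel_left₀ (Real.sqrt_pos.2 hv).ne']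
  · congr 1
    · simp
    · ext
      have h' : (σ : ℝ) ≤ τ := h
      simp [Real.sq_sqrt hv.le, NNReal.coe_sub h, Real.dist_eq, abs_of_nonneg (sub_nonneg.2 h')]

theorem covariance_timeChanged (hX : IsDeltaRSMPRIR X P γ α p δ r) (σ τ : ℝ≥0) :
    covariance (timeChanged X (α 1) σ) (timeChanged X (α 1) τ) P =
      stationaryVar X P * min (σ : ℝ) τ := by
  have hv : (0 : ℝ) < stationaryVar X P := hX.stationaryVar_pos
  rw [hX.timeChanged_eq]
  simp only [smul_eq_mul]
  rw [covariance_const_mul_left, covariance_const_mul_right,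
    hX.isPreBrownianReal.covariance_fun_eval, ← mul_assoc, Real.mul_self_sqrt hv.le]
  simp

end IsDeltaRSMPRIR

end

noncomputable section

/-! ### Moment generating functions -/

/-- A power series that vanishes near `0` has zero coefficients. -/
theorem coeff_eq_zero_of_hasSum {d : ℕ → ℝ} {r : ℝ} (hr : 0 < r)
    (h : ∀ y : ℝ, |y| < r → HasSum (fun n => d n * y ^ n) 0) (n : ℕ) : d n = 0 := by
  have hp : HasFPowerSeriesAt (fun _ : ℝ => (0 : ℝ)) (FormalMultilinearSeries.ofScalars ℝ d) 0 := by
    rw [hasFPowerSeriesAt_iff]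
    filter_upwards [Metric.ball_mem_nhds (0 : ℝ) hr] with y hy
    have := h y (by simpa using hy)
    simpa [FormalMultilinearSeries.coeff_ofScalars, mul_comm] using this
  have h0 : FormalMultilinearSeries.ofScalars ℝ d = 0 := HasFPowerSeriesAt.eq_zero hp
  have := congrArg (fun q => q.coeff n) h0
  rw [FormalMultilinearSeries.coeff_ofScalars] at this
  exact this

section MGF

variable {Ω : Type*} [MeasurableSpace Ω] {P : Measure Ω} {Z : Ω → ℝ} {w : ℝ≥0} {c : ℕ → ℝ}

theorem mgfEqExpSeries_of_gaussian (hZ : HasLaw Z (gaussianReal 0 w) P) (h2 : c 2 = w)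
    (h3 : ∀ j, c (j + 3) = 0) (y : ℝ) : MGFEqExpSeries Z P c y := by
  have hint : Integrable (fun ω => Real.exp (y * Z ω)) P := by
    have h := integrable_exp_mul_gaussianReal (μ := 0) (v := w) y
    rw [← hZ.map_eq, integrable_map_measure (by fun_prop) hZ.aemeasurable] at h
    exact h
  have hzero : ∀ j, j ∉ ({0} : Finset ℕ) → c (j + 2) * y ^ (j + 2) / ((j + 2)! : ℝ) = 0 := by
    intro j hj
    obtain ⟨k, rfl⟩ := Nat.exists_eq_succ_of_ne_zero (by simpa using hj)
    rw [show k.succ + 2 = k + 3 by omega, h3, zero_mul, zero_div]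
  refine ⟨hint, summable_of_ne_finset_zero hzero, ?_⟩
  rw [tsum_eq_sum hzero]
  have h := mgf_gaussianReal hZ.map_eq y
  rw [mgf] at h
  rw [h]
  simp [h2]

theorem cumulants_of_gaussian (hZ : HasLaw Z (gaussianReal 0 w) P) {r : ℝ} (hr : 0 < r)
    (h : ∀ y : ℝ, |y| < r → MGFEqExpSeries Z P c y) : c 2 = w ∧ ∀ j, c (j + 3) = 0 := by
  -- Coefficients of the given exponent minus the Gaussian exponent w y²/2. Equality of the
  -- exponentials near 0 makes this power series vanish there.
  set d : ℕ → ℝ := fun n => if n < 2 then 0 else c n / (n ! : ℝ) - if n = 2 then w / 2 else 0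
    with hd
  have hsum : ∀ y : ℝ, |y| < r → HasSum (fun n => d n * y ^ n) 0 := by
    intro y hy
    obtain ⟨-, hs, he⟩ := h y hy
    have hg := mgf_gaussianReal hZ.map_eq y
    rw [mgf, he, Real.exp_eq_exp] at hg
    have h1 := hs.hasSum
    rw [hg] at h1
    have h2 : HasSum (fun j : ℕ => if j = 0 then (w : ℝ) * y ^ 2 / 2 else 0) (w * y ^ 2 / 2) :=
      hasSum_ite_eq 0 _
    have h3 := h1.sub h2
    rw [← hasSum_nat_add_iff' 2]
    convert! h3 using 1
    · ext j
      rcases Nat.eq_zero_or_pos j with rfl | hj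
      · simp [hd]; ring
      · have : j ≠ 0 := by omega
        simp [hd, this]; ring
    · simp [hd, Finset.sum_range_succ]
  have hd0 := coeff_eq_zero_of_hasSum hr hsum
  refine ⟨?_, fun j => ?_⟩
  · have := hd0 2
    simp [hd] at this
    linarith
  · have := hd0 (j + 3)
    simp [hd, Nat.factorial_ne_zero] at this
    exact this

end MGF

/-! ### Gaussian integration by parts on polynomials -/

/-- Integration of polynomials as a linear functional. -/
def polyIntegral (μ : Measure ℝ) (h : ∀ q : ℝ[X], Integrable (fun x => q.eval x) μ) :
    ℝ[X] →ₗ[ℝ] ℝ where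
  toFun q := ∫ x, q.eval x ∂μ
  map_add' f g := by simp only [eval_add]; exact integral_add (h f) (h g)
  map_smul' a f := by simp only [eval_smul, smul_eq_mul, RingHom.id_apply]; exact integral_const_mul _ _

theorem integrable_eval_gaussianReal (v : ℝ≥0) (q : ℝ[X]) :
    Integrable (fun x => q.eval x) (gaussianReal 0 v) := by
  simp only [eval_eq_sum_range]
  exact integrable_finsetSum _ fun n _ => (integrable_pow_gaussianReal v n).const_mul _

/-- On monomials this is the two-step Gaussian moment recurrence, together with the vanishing first
moment for the constants. -/
theorem polyIntegral_X_mul (v : ℝ≥0) (q : ℝ[X]) :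
    polyIntegral (gaussianReal 0 v) (integrable_eval_gaussianReal v) (Polynomial.X * q) =
      v * polyIntegral (gaussianReal 0 v) (integrable_eval_gaussianReal v) (derivative q) := by
  induction q using Polynomial.induction_on' with
  | add f g hf hg => rw [mul_add, map_add, hf, hg, derivative_add, map_add, mul_add]
  | monomial n a =>
    rw [X_mul_monomial, derivative_monomial]
    show ∫ x, (monomial (n + 1) a).eval x ∂_ = v * ∫ x, (monomial (n - 1) (a * n)).eval x ∂_
    simp only [eval_monomial]
    rw [integral_const_mul, integral_const_mul]
    rcases n with _ | n
    · simp
    · rw [integral_pow_add_two_gaussianReal]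
      rw [Nat.add_sub_cancel]
      push_cast
      ring

/-! ### Linear interpolation, the Markov property and the harness property -/

theorem harness_coefficients {s t u : ℝ} (hst : s ≤ t) (htu : t ≤ u) :
    ∃ a b : ℝ, a + b = 1 ∧ a * s + b * u = t := by
  rcases (hst.trans htu).eq_or_lt with h | h
  · exact ⟨1, 0, by norm_num, by linarith⟩
  · have h' : u - s ≠ 0 := by linarith
    refine ⟨(u - t) / (u - s), (t - s) / (u - s), ?_, ?_⟩ <;> field_simp <;> ring

theorem totalDegree_linear {a b : ℝ} (h : a + b = 1) :
    (MvPolynomial.C a * MvPolynomial.X 0 + MvPolynomial.C b * MvPolynomial.X 1 :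
      MvPolynomial (Fin 2) ℝ).totalDegree = 1 := by
  set Q : MvPolynomial (Fin 2) ℝ :=
    MvPolynomial.C a * MvPolynomial.X 0 + MvPolynomial.C b * MvPolynomial.X 1 with hQ
  have hmono : ∀ (c : ℝ) (i : Fin 2),
      (MvPolynomial.C c * MvPolynomial.X i : MvPolynomial (Fin 2) ℝ).totalDegree ≤ 1 := fun c i =>
    (MvPolynomial.totalDegree_mul _ _).trans (by simp)
  refine le_antisymm ((MvPolynomial.totalDegree_add _ _).trans (max_le (hmono _ _) (hmono _ _)))
    (Nat.one_le_iff_ne_zero.2 fun h0 => ?_)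
  have hC := MvPolynomial.totalDegree_eq_zero_iff_eq_C.1 h0
  -- The values a + b = 1 at (1,1) and 0 at (0,0) differ, so the polynomial is not constant.
  have e1 := congrArg (MvPolynomial.eval ![1, 1]) hC
  have e0 := congrArg (MvPolynomial.eval ![0, 0]) hC
  rw [MvPolynomial.eval_C] at e0 e1
  rw [← e0] at e1
  simp [hQ] at e1
  linarith

namespace IsDeltaRSMPRIR

variable {Ω : Type*} [MeasurableSpace Ω] {P : Measure Ω} [IsProbabilityMeasure P]
  {X : ℝ → Ω → ℝ} {γ : ℕ → ℕ → ℝ → ℝ} {α : ℕ → ℝ} {p : ℕ → ℝ[X]} {δ : ℕ → ℝ} {r : ℝ}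

omit [MeasurableSpace Ω] in
theorem _root_.eq_timeChanged (X : ℝ → Ω → ℝ) {a : ℝ} (ha : a ≠ 0) (t : ℝ) :
    X t = fun ω => (Real.sqrt (Real.exp (2 * a * t)))⁻¹ *
      timeChanged X a (.mk (Real.exp (2 * a * t)) (Real.exp_pos _).le) ω := by
  ext ω
  have h : 2 * a * t / (2 * a) = t := by field_simp
  simp only [timeChanged, NNReal.coe_mk, Real.log_exp, h]
  rw [inv_mul_cancel_left₀ (Real.sqrt_pos.2 (Real.exp_pos _)).ne']

/-- For s > 0 the increasing time change and nonzero scaling factors leave the past and present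
σ-algebras unchanged; at s = 0 both are trivial. -/
theorem isMarkovProcess_timeChanged (hX : IsDeltaRSMPRIR X P γ α p δ r) :
    IsMarkovProcess (timeChanged X (α 1)) P := by
  refine ⟨hX.measurable_timeChanged, fun s t hst B hB => ?_⟩
  have ha := hX.alpha_one_pos
  rcases eq_or_ne s 0 with rfl | h0
  · rw [pastSigma_timeChanged_zero, timeChanged_zero X (α 1), MeasurableSpace.comap_const]
  have hs : 0 < s := pos_iff_ne_zero.2 h0
  have hs' : (0 : ℝ) < s := hs
  have hpast : pastSigma (timeChanged X (α 1)) s = pastSigma X (Real.log s / (2 * α 1)) := by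
    refine le_antisymm (hX.pastSigma_timeChanged_le s) (iSup₂_le fun q hq => ?_)
    rw [← measurable_iff_comap_le, eq_timeChanged X ha.ne' q]
    refine (measurable_pastSigma ?_).const_mul _
    have h1 : 2 * α 1 * q ≤ Real.log s := by
      have := (le_div_iff₀ (by positivity : 0 < 2 * α 1)).1 hq
      linarith
    exact (Real.le_log_iff_exp_le hs').1 h1
  have hcomap : MeasurableSpace.comap (timeChanged X (α 1) s) inferInstance =
      MeasurableSpace.comap (X (Real.log s / (2 * α 1))) inferInstance := by
    refine le_antisymm ?_ ?_ <;> rw [← measurable_iff_comap_le]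
    · exact (comap_measurable _).const_mul _
    · have h := (comap_measurable (timeChanged X (α 1) s)).const_mul (Real.sqrt s)⁻¹
      have e : (fun ω => (Real.sqrt s)⁻¹ * timeChanged X (α 1) s ω) =
          X (Real.log s / (2 * α 1)) := by
        ext ω
        simp only [timeChanged]
        rw [inv_mul_cancel_left₀ (Real.sqrt_pos.2 hs').ne']
      rwa [e] at h
  rw [hpast, hcomap]
  exact hX.stationaryMarkov.markov.2 _ _ (hX.log_div_le hs hst) ((Real.sqrt t * ·) ⁻¹' B)
    (measurable_const_mul _ hB)

/-- The deviation from linear interpolation is independent of the two-sided field. -/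
theorem indep_interpolation (hX : IsDeltaRSMPRIR X P γ α p δ r) {s t u : ℝ≥0} (hst : s ≤ t)
    (htu : t ≤ u) {a b : ℝ} (hab : a + b = 1) (hlin : a * s + b * u = t) :
    Indep (MeasurableSpace.comap (fun ω => timeChanged X (α 1) t ω -
        (a * timeChanged X (α 1) s ω + b * timeChanged X (α 1) u ω)) inferInstance)
      (outerSigma (timeChanged X (α 1)) s u) P := by
  set Y := timeChanged X (α 1) with hY
  have hYm : ∀ τ, Measurable (Y τ) := hX.measurable_timeChanged
  have hG := hX.isGaussianProcess_timeChanged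
  rw [← hY] at hG
  have hL2 : ∀ τ, MemLp (Y τ) 2 P := fun τ => (hG.hasGaussianLaw_eval τ).memLp_two
  let U : ((Set.Ioo s u)ᶜ : Set ℝ≥0) → Ω → ℝ := fun q => Y q
  let V : Unit → Ω → ℝ := fun _ ω => Y t ω - (a * Y s ω + b * Y u ω)
  have hUV : IsGaussianProcess (Sum.elim U V) P := by
    refine hG.of_isGaussianProcess fun i => ?_
    rcases i with q | _
    · exact ⟨{q.1}, ContinuousLinearMap.proj ⟨q.1, by simp⟩, fun ω => rfl⟩
    · classical
      exact ⟨{t, s, u}, ContinuousLinearMap.proj ⟨t, by simp⟩ -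
        (a • ContinuousLinearMap.proj ⟨s, by simp⟩ + b • ContinuousLinearMap.proj ⟨u, by simp⟩),
        fun ω => rfl⟩
  have hVm : Measurable (V ()) := (hYm t).sub (((hYm s).const_mul a).add ((hYm u).const_mul b))
  have hind := hUV.indepFun_of_covariance_eq_zero (fun q => (hYm q).aemeasurable)
    (fun _ => hVm.aemeasurable) fun q _ => by
      show covariance (Y q) (fun ω => Y t ω - (a * Y s ω + b * Y u ω)) P = 0
      have h1 : MemLp (fun ω => a * Y s ω) 2 P := (hL2 s).const_mul a
      have h2 : MemLp (fun ω => b * Y u ω) 2 P := (hL2 u).const_mul b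
      have h3 : MemLp (fun ω => a * Y s ω + b * Y u ω) 2 P := h1.add h2
      have hadd : covariance (Y q) (fun ω => a * Y s ω + b * Y u ω) P =
          covariance (Y q) (fun ω => a * Y s ω) P + covariance (Y q) (fun ω => b * Y u ω) P :=
        covariance_add_right (hL2 _) h1 h2
      rw [covariance_fun_sub_right (hL2 _) (hL2 _) h3, hadd, covariance_const_mul_right,
        covariance_const_mul_right, hX.covariance_timeChanged, hX.covariance_timeChanged,
        hX.covariance_timeChanged]
      have hst' : (s : ℝ) ≤ t := hst
      have htu' : (t : ℝ) ≤ u := htu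
      have hq : q.1 ≤ s ∨ u ≤ q.1 := by
        have := q.2
        simp only [Set.mem_compl_iff, Set.mem_Ioo, not_and_or, not_lt] at this
        exact this
      -- The covariance v min(q, ·) is constant to the right of q and linear to its left: for q ≤ s
      -- cancellation needs a + b = 1, for q ≥ u it needs a s + b u = t.
      rcases hq with hq | hq
      · have hq' : (q.1 : ℝ) ≤ s := hq
        rw [min_eq_left (hq'.trans hst'), min_eq_left hq',
          min_eq_left (hq'.trans (hst'.trans htu'))]
        linear_combination (-(stationaryVar X P : ℝ) * q.1) * hab
      · have hq' : (u : ℝ) ≤ q.1 := hq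
        rw [min_eq_right (htu'.trans hq'), min_eq_right ((hst'.trans htu').trans hq'),
          min_eq_right hq']
        linear_combination (-(stationaryVar X P : ℝ)) * hlin
  rw [IndepFun_iff_Indep] at hind
  refine (indep_of_indep_of_le_left (indep_of_indep_of_le_right hind ?_) ?_).symm
  · rw [← measurable_iff_comap_le]
    exact (measurable_pi_apply ()).comp (comap_measurable fun ω (x : Unit) => V x ω)
  · refine iSup₂_le fun q hq => ?_
    rw [← measurable_iff_comap_le]
    exact (measurable_pi_apply (⟨q, hq⟩ : ((Set.Ioo s u)ᶜ : Set ℝ≥0))).comp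
      (comap_measurable fun ω x => U x ω)

theorem isHarness_timeChanged (hX : IsDeltaRSMPRIR X P γ α p δ r) :
    IsHarness (timeChanged X (α 1)) P := by
  have hG := hX.isGaussianProcess_timeChanged
  set Y := timeChanged X (α 1) with hY
  have hYm : ∀ τ, Measurable (Y τ) := hX.measurable_timeChanged
  have hint : ∀ τ, Integrable (Y τ) P := fun τ => (hG.hasGaussianLaw_eval τ).integrable
  have hmean : ∀ τ, ∫ ω, Y τ ω ∂P = 0 := fun τ => by
    show ∫ ω, Real.sqrt τ * X _ ω ∂P = 0
    rw [integral_const_mul, hX.integral_eq_zero, mul_zero]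
  refine ⟨hX.isMarkovProcess_timeChanged, fun t => by simpa using (hint t).abs,
    fun s t u hst htu => ?_⟩
  obtain ⟨a, b, hab, hlin⟩ := harness_coefficients (NNReal.coe_le_coe.2 hst)
    (NNReal.coe_le_coe.2 htu)
  refine ⟨_, totalDegree_linear hab, ?_⟩
  have hle : outerSigma Y s u ≤ ‹MeasurableSpace Ω› := iSup₂_le fun q _ => (hYm q).comap_le
  have hmeas : ∀ q, q ∉ Set.Ioo s u → Measurable[outerSigma Y s u] (Y q) := fun q hq =>
    (comap_measurable (Y q)).mono (le_iSup₂_of_le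
      (f := fun q (_ : q ∈ (Set.Ioo s u)ᶜ) => MeasurableSpace.comap (Y q) inferInstance)
      q hq le_rfl) le_rfl
  set I : Ω → ℝ := fun ω => a * Y s ω + b * Y u ω with hI
  have hIint : Integrable I P := ((hint s).const_mul a).add ((hint u).const_mul b)
  have hImeas : Measurable[outerSigma Y s u] I :=
    ((hmeas s (by simp)).const_mul a).add ((hmeas u (by simp)).const_mul b)
  have hsplit : (fun ω => Y t ω ^ 1) = (fun ω => Y t ω - I ω) + I := by
    ext ω; simp
  -- The deviation is independent of the two-sided field, so its conditional expectation is its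
  -- mean, which is 0.
  have hdev := condExp_indep_eq (μ := P)
    (((hYm t).sub (hImeas.mono hle le_rfl)).comap_le) hle
    (comap_measurable (fun ω => Y t ω - I ω)).stronglyMeasurable
    (hX.indep_interpolation hst htu hab hlin)
  have hzero : ∫ ω, (Y t ω - I ω) ∂P = 0 := by
    rw [integral_sub (hint t) hIint, hI,
      integral_add ((hint s).const_mul a) ((hint u).const_mul b), integral_const_mul,
      integral_const_mul, hmean, hmean, hmean]
    simp
  rw [hsplit]
  filter_upwards [condExp_add ((hint t).sub hIint) hIint (outerSigma Y s u), hdev] with ω h1 h2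
  have h1' : (P[(fun ω => Y t ω - I ω) + I | outerSigma Y s u]) ω =
    (P[fun ω => Y t ω - I ω | outerSigma Y s u]) ω + (P[I | outerSigma Y s u]) ω := h1
  rw [h1', h2, hzero, condExp_of_stronglyMeasurable hle hImeas.stronglyMeasurable hIint]
  simp [hI]

/-! ### One-dimensional laws, cumulants and the three equivalent conditions -/

theorem hasLaw_timeChanged (hX : IsDeltaRSMPRIR X P γ α p δ r) (τ : ℝ≥0) :
    HasLaw (timeChanged X (α 1) τ) (gaussianReal 0 (stationaryVar X P * τ)) P := by
  have h := hX.hasLaw_increment (zero_le (a := τ))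
  simpa [timeChanged_zero] using h

theorem cumulants (hX : IsDeltaRSMPRIR X P γ α p δ r) :
    δ 2 = stationaryVar X P ∧ ∀ j, δ (j + 3) = 0 :=
  cumulants_of_gaussian ⟨(hX.measurable 0).aemeasurable, hX.map_zero_eq⟩ hX.radius_pos hX.mgf_eq

theorem isLevyProcess_timeChanged (hX : IsDeltaRSMPRIR X P γ α p δ r) :
    IsLevyProcess (timeChanged X (α 1)) P where
  zero := by rw [timeChanged_zero]; rfl
  indep := hX.hasIndepIncrements_timeChanged
  stationary s t hst :=
    ⟨(hX.hasLaw_increment hst).aemeasurable, (hX.hasLaw_timeChanged _).aemeasurable,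
      (hX.hasLaw_increment hst).map_eq.trans (hX.hasLaw_timeChanged _).map_eq.symm⟩

theorem isOrnsteinUhlenbeck (hX : IsDeltaRSMPRIR X P γ α p δ r) : IsOrnsteinUhlenbeck X P := by
  refine ⟨?_, hX.integral_eq_zero, α 1, _, hX.alpha_one_pos, hX.integral_sq_pos,
    hX.covariance_eq⟩
  have h := (hX.isGaussianProcess_timeChanged.comp_right
    fun t : ℝ => .mk (Real.exp (2 * α 1 * t)) (Real.exp_pos _).le).smul
      fun t => (Real.sqrt (Real.exp (2 * α 1 * t)))⁻¹
  convert! h using 1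
  ext t ω
  exact congrFun (eq_timeChanged X hX.alpha_one_pos.ne' t) ω

theorem areHermitePolynomials (hX : IsDeltaRSMPRIR X P γ α p δ r) :
    AreHermitePolynomials (orthonormalPoly X P p) := by
  have hv : (0 : ℝ) < stationaryVar X P := hX.stationaryVar_pos
  set v := stationaryVar X P with hvdef
  set s := Real.sqrt v with hs
  have hs0 : s ≠ 0 := (Real.sqrt_pos.2 hv).ne'
  have hs2 : s ^ 2 = v := Real.sq_sqrt hv.le
  have hL := polyIntegral_X_mul v
  set L := polyIntegral (gaussianReal 0 v) (integrable_eval_gaussianReal v) with hLdef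
  have hL1 : L 1 = 1 := by simp [hLdef, polyIntegral]
  have ho : ∀ m n, m ≠ n → L (p m * p n) = 0 := by
    intro m n hmn
    have := hX.orthogonal m n hmn
    rw [hX.map_zero_eq] at this
    simpa [hLdef, polyIntegral] using this
  have hp : ∀ n, p n = varHermite v n :=
    eq_varHermite_of_orthogonal hL hL1 hv.ne' hX.monic hX.natDegree ho
  refine ⟨v, hv, fun n x => ?_⟩
  -- The norm s^n √(n!) carries the same factor s^n as p_n(x) = s^n He_n(x/s), so it cancels on
  -- normalization.
  have hnorm : ∫ ω, ((p n).eval (X 0 ω)) ^ 2 ∂P = (s ^ n) ^ 2 * (n ! : ℝ) := by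
    rw [← integral_map (f := fun x => ((p n).eval x) ^ 2) (hX.measurable 0).aemeasurable
      (by fun_prop), hX.map_zero_eq]
    have := functional_varHermite_sq hL hL1 n
    rw [← hp] at this
    rw [← pow_mul, mul_comm n 2, pow_mul, hs2, ← this]
    simp [hLdef, polyIntegral, pow_two, hvdef]
  rw [← hs, orthonormalPoly, hnorm, eval_mul, eval_C, hp, ← hs2, eval_varHermite hs0,
    Real.sqrt_mul (by positivity), Real.sqrt_sq (by positivity), mul_inv]
  have : s ^ n ≠ 0 := pow_ne_zero _ hs0
  field_simp

end IsDeltaRSMPRIR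

end

/-- Regularity makes the stationary process reversible, and a reversible linear autoregression
with independent innovations is Gaussian: the moments of `X_0` satisfy the recurrence of a normal
law, which is therefore the law of `X_0`. Hence `X` is an Ornstein-Uhlenbeck process, the
time-changed process is a multiple of a Brownian motion, and the `h_n` are Hermite polynomials, so
the three equivalent conditions of the last part all hold. -/
theorem mainTheorem6 {Ω : Type*} [MeasurableSpace Ω] (P : Measure Ω) [IsProbabilityMeasure P]
    (X : ℝ → Ω → ℝ) (γ : ℕ → ℕ → ℝ → ℝ) (α : ℕ → ℝ) (p : ℕ → ℝ[X]) (δ : ℕ → ℝ) (r : ℝ)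
    (hX : IsDeltaRSMPRIR X P γ α p δ r) :
    HasIndepIncrements (timeChanged X (α 1)) P ∧
    IsHarness (timeChanged X (α 1)) P ∧
    (∀ (τ : ℝ≥0) (y : ℝ), Real.sqrt τ * |y| < r →
      MGFEqExpSeries (timeChanged X (α 1) τ) P
        (fun j => δ j * (τ : ℝ) ^ ((j : ℝ) / 2)) y) ∧
    (∀ (σ τ : ℝ≥0) (y : ℝ), σ < τ → Real.sqrt τ * |y| < r →
      MGFEqExpSeries (fun ω => timeChanged X (α 1) τ ω - timeChanged X (α 1) σ ω) P
        (fun j => δ j * ((τ : ℝ) ^ ((j : ℝ) / 2) - (σ : ℝ) ^ ((j : ℝ) / 2))) y) ∧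
    (IsLevyProcess (timeChanged X (α 1)) P ↔ IsOrnsteinUhlenbeck X P) ∧
    (IsOrnsteinUhlenbeck X P ↔ AreHermitePolynomials (orthonormalPoly X P p)) := by
  obtain ⟨h2, h3⟩ := hX.cumulants
  refine ⟨hX.hasIndepIncrements_timeChanged, hX.isHarness_timeChanged, fun τ y _ => ?_,
    fun σ τ y h _ => ?_, iff_of_true hX.isLevyProcess_timeChanged hX.isOrnsteinUhlenbeck,
    iff_of_true hX.isOrnsteinUhlenbeck hX.areHermitePolynomials⟩
  · exact mgfEqExpSeries_of_gaussian (hX.hasLaw_timeChanged τ) (by simp [h2]) (by simp [h3]) y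
  · refine mgfEqExpSeries_of_gaussian (hX.hasLaw_increment h.le) ?_ (by simp [h3]) y
    simp [h2, NNReal.coe_sub h.le]
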